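/- Let $(a,b,c)$ be one of the six sporadic triples $(7,2,-8)$, $(10,3,9)$, $(-17,-6,72)$, $(12,4,32)$, $(-9,-3,27)$, $(11,3,-1)$, and let $\{u_n\}$ be the corresponding sporadic Apéry-like sequence, defined by $u_{-1}=0$, $u_0=1$ and $$(n+1)^2u_{n+1}=(an^2+an+b)u_n-cn^2u_{n-1}\qquad(n\ge 0).$$ Put $$x=\frac{(X+Y)(1+cXY)-2aXY}{(1-cXY)^2},\qquad y=\frac{XY(1-aX+cX^2)(1-aY+cY^2)}{((X+Y)(1+cXY)-2aXY)^2}.$$ Then for all complex $(X,Y)$ in some neighbourhood of $(0,0)$ at which $(X+Y)(1+cXY)-2aXY\ne 0$ (so that $y$ is defined; $x$ is then defined as well), all the series below converge absolutely (the one on the left as a series in $n$) and $$\sum_{n=0}^\infty u_n\sum_{m=0}^{\lfloor n/2\rfloor}\binom{2m}{m}\binom{n}{2m}x^ny^m=(1-cXY)\left(\sum_{n=0}^\infty u_nX^n\right)\left(\sum_{n=0}^\infty u_nY^n\right).$$ Moreover, write $\theta_x=x\,\partial/\partial x$ and $\theta_y=y\,\partial/\partial y$, where now $x,y$ are independent complex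 variables. The series $$S(x,y)=\sum_{n=0}^\infty u_n\sum_{m=0}^{\lfloor n/2\rfloor}\binom{2m}{m}\binom{n}{2m}x^ny^m$$ converges for all $(x,y)$ in a neighbourhood of $(0,0)$, has $S(0,0)=1$, is holomorphic near $(0,0)$, and satisfies near $(0,0)$ the system $$\theta_x(\theta_x-2\theta_y)F-x(a\theta_x^2+a\theta_x+b)F+cx^2(\theta_x+1)^2F+cx^2(\theta_x+1)\bigl(4y\theta_x+(2-8y)\theta_y\bigr)F=0,$$ $$\theta_y^2F-y(2\theta_y-\theta_x+1)(2\theta_y-\theta_x)F=0;$$ and every solution $F$ of this system that is holomorphic near $(0,0)$ equals a constant multiple of $S$ near $(0,0)$. -/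

import Mathlib

open Filter Topology

noncomputable section

/-- The six sporadic parameter triples `(a, b, c)`. -/
def sporadicTriples : Set (ℂ × ℂ × ℂ) :=
  {(7, 2, -8), (10, 3, 9), (-17, -6, 72), (12, 4, 32), (-9, -3, 27), (11, 3, -1)}

/-- The sequence with `u 0 = 1` and
`(n + 1)² u (n + 1) = (a n² + a n + b) u n - c n² u (n - 1)` for `n ≥ 0` (where `u (-1) = 0`). -/
def aperySeq (a b c : ℂ) : ℕ → ℂ
  | 0 => 1
  | 1 => b
  | n + 2 =>
      ((a * ((n : ℂ) + 1) ^ 2 + a * ((n : ℂ) + 1) + b) * aperySeq a b c (n + 1)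
        - c * ((n : ℂ) + 1) ^ 2 * aperySeq a b c n) / ((n : ℂ) + 2) ^ 2

/-- The defining recursion, for every `n`; at `n = 0` the last term has the factor `0`, so the
value used there for the index `n - 1` plays no role. -/
theorem aperySeq_rec (a b c : ℂ) (n : ℕ) :
    ((n : ℂ) + 1) ^ 2 * aperySeq a b c (n + 1) =
      (a * (n : ℂ) ^ 2 + a * (n : ℂ) + b) * aperySeq a b c n
        - c * (n : ℂ) ^ 2 * aperySeq a b c (n - 1) := by
  cases n with
  | zero => simp [aperySeq]
  | succ k =>
    have h : ((k : ℂ) + 2) ≠ 0 := by exact_mod_cast (Nat.succ_ne_zero (k + 1))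
    simp only [aperySeq, Nat.add_sub_cancel]
    push_cast
    have h2 : ((k : ℂ) + 1 + 1) = (k : ℂ) + 2 := by ring
    rw [h2]
    field_simp

/-- `(X + Y)(1 + cXY) - 2aXY`. -/
def wzNum (a c X Y : ℂ) : ℂ := (X + Y) * (1 + c * X * Y) - 2 * a * X * Y

/-- `x = ((X + Y)(1 + cXY) - 2aXY) / (1 - cXY)²`. -/
def wzX (a c X Y : ℂ) : ℂ := wzNum a c X Y / (1 - c * X * Y) ^ 2

/-- `y = XY(1 - aX + cX²)(1 - aY + cY²) / ((X + Y)(1 + cXY) - 2aXY)²`. -/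
def wzY (a c X Y : ℂ) : ℂ :=
  X * Y * (1 - a * X + c * X ^ 2) * (1 - a * Y + c * Y ^ 2) / wzNum a c X Y ^ 2

/-- The `n`-th term `u n * ∑_{m ≤ n/2} C(2m, m) C(n, 2m) x^n y^m`. -/
def wzTerm (u : ℕ → ℂ) (x y : ℂ) (n : ℕ) : ℂ :=
  u n * ∑ m ∈ Finset.range (n / 2 + 1),
    ((2 * m).choose m : ℂ) * (n.choose (2 * m) : ℂ) * x ^ n * y ^ m

/-- The two-variable series `∑ n, wzTerm u x y n` as a function of `(x, y)`. -/
def wzSeries (u : ℕ → ℂ) (p : ℂ × ℂ) : ℂ := ∑' n, wzTerm u p.1 p.2 n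

/-- The Euler operator `θ_x = x ∂/∂x`. -/
def thetaX (F : ℂ × ℂ → ℂ) (p : ℂ × ℂ) : ℂ := p.1 * deriv (fun s => F (s, p.2)) p.1

/-- The Euler operator `θ_y = y ∂/∂y`. -/
def thetaY (F : ℂ × ℂ → ℂ) (p : ℂ × ℂ) : ℂ := p.2 * deriv (fun s => F (p.1, s)) p.2

/-- `θ_x(θ_x - 2θ_y)F - x(aθ_x² + aθ_x + b)F + cx²(θ_x + 1)²F
  + cx²(θ_x + 1)(4yθ_x + (2 - 8y)θ_y)F`. -/
def pdeOp₁ (a b c : ℂ) (F : ℂ × ℂ → ℂ) (p : ℂ × ℂ) : ℂ :=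
  thetaX (fun q => thetaX F q - 2 * thetaY F q) p
    - p.1 * (a * thetaX (thetaX F) p + a * thetaX F p + b * F p)
    + c * p.1 ^ 2 * (thetaX (fun q => thetaX F q + F q) p + (thetaX F p + F p))
    + c * p.1 ^ 2 *
      (thetaX (fun q => 4 * q.2 * thetaX F q + (2 - 8 * q.2) * thetaY F q) p
        + (4 * p.2 * thetaX F p + (2 - 8 * p.2) * thetaY F p))

/-- `θ_y²F - y(2θ_y - θ_x + 1)(2θ_y - θ_x)F`. -/
def pdeOp₂ (F : ℂ × ℂ → ℂ) (p : ℂ × ℂ) : ℂ :=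
  thetaY (thetaY F) p
    - p.2 * (2 * thetaY (fun q => 2 * thetaY F q - thetaX F q) p
        - thetaX (fun q => 2 * thetaY F q - thetaX F q) p
        + (2 * thetaY F p - thetaX F p))

/-- `F` is holomorphic in a neighbourhood of `(0, 0)` and satisfies both equations there. -/
def IsHolSolution (a b c : ℂ) (F : ℂ × ℂ → ℂ) : Prop :=
  AnalyticAt ℂ F (0, 0) ∧ ∀ᶠ p in 𝓝 ((0, 0) : ℂ × ℂ), pdeOp₁ a b c F p = 0 ∧ pdeOp₂ F p = 0

end

/-! The system for S is solved on Taylor coefficients. Write t(n, m) = C(2m, m) C(n, 2m), so that S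
has coefficients u_n t(n, m). The second equation is the recursion of t in m. The first one reduces,
by two identities for t in n, to t(n, m) times the Apéry recursion at n. Conversely, the first
equation at y-degree 0 determines the coefficients of x^i successively from the constant term, and
the second then determines each coefficient of x^i y^(j+1) from that of x^i y^j. So the holomorphic
solutions form a line spanned by S.

For the product formula, y is singular at the origin as a function of (X, Y), but z = x² y is
holomorphic there, like x. Since t(n, m) = 0 for n < 2m, S is a power series T(x, z), and the system
becomes two second-order equations for T (`regSeries_pde`). Put G(X, Y) = T(x, z) / (1 - cXY). By
the chain rule and rational function identities, the Apéry operator θ² - X(aθ² + aθ + b) + cX²(θ +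
1)² in X, applied to G, is a combination of these two equations, hence zero
(`apery_operator_identity`, `aperyOp_pulledSeries`). So the coefficients of G obey the Apéry
recursion in the X-index: G is ∑ u_n X^n times G(0, Y). At X = 0 one has x = Y and z = 0, whence
G(0, Y) = ∑ u_n Y^n (`pulledSeries_eq_mul`). -/

/-! ### Double power series and their termwise calculus. -/

/-- `F (x, y) = ∑ A i j x^i y^j` on the polydisc of radius `ρ`. -/
def HasDoubleSeries (F : ℂ × ℂ → ℂ) (A : ℕ → ℕ → ℂ) (ρ : ℝ) : Prop :=
  ∀ p : ℂ × ℂ, ‖p.1‖ < ρ → ‖p.2‖ < ρ →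
    HasSum (fun k : ℕ × ℕ => A k.1 k.2 * p.1 ^ k.1 * p.2 ^ k.2) (F p)

namespace HasDoubleSeries

variable {F G : ℂ × ℂ → ℂ} {A B : ℕ → ℕ → ℂ} {ρ : ℝ}

theorem mono {ρ' : ℝ} (h : HasDoubleSeries F A ρ) (hr : ρ' ≤ ρ) : HasDoubleSeries F A ρ' :=
  fun p h1 h2 => h p (h1.trans_le hr) (h2.trans_le hr)

theorem congr (h : HasDoubleSeries F A ρ)
    (hFG : ∀ p : ℂ × ℂ, ‖p.1‖ < ρ → ‖p.2‖ < ρ → G p = F p) (hAB : ∀ i j, B i j = A i j) :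
    HasDoubleSeries G B ρ := by
  intro p h1 h2
  rw [hFG p h1 h2]
  simpa only [hAB] using h p h1 h2

theorem add (hF : HasDoubleSeries F A ρ) (hG : HasDoubleSeries G B ρ) :
    HasDoubleSeries (fun p => F p + G p) (fun i j => A i j + B i j) ρ := fun p h1 h2 => by
  simpa only [add_mul] using (hF p h1 h2).add (hG p h1 h2)

theorem sub (hF : HasDoubleSeries F A ρ) (hG : HasDoubleSeries G B ρ) :
    HasDoubleSeries (fun p => F p - G p) (fun i j => A i j - B i j) ρ := fun p h1 h2 => by
  simpa only [sub_mul] using (hF p h1 h2).sub (hG p h1 h2)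

theorem const_mul (k : ℂ) (hF : HasDoubleSeries F A ρ) :
    HasDoubleSeries (fun p => k * F p) (fun i j => k * A i j) ρ := fun p h1 h2 => by
  simpa only [mul_assoc] using (hF p h1 h2).mul_left k

theorem swap (hF : HasDoubleSeries F A ρ) :
    HasDoubleSeries (fun p => F p.swap) (fun i j => A j i) ρ := fun p h1 h2 => by
  have := (Equiv.prodComm ℕ ℕ).hasSum_iff.mpr (hF p.swap h2 h1)
  refine HasSum.congr_fun this fun k => ?_
  simp [Function.comp, mul_right_comm]

/-- Coefficients of `x * F`. -/
theorem fst_mul (hF : HasDoubleSeries F A ρ) :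
    HasDoubleSeries (fun p => p.1 * F p) (fun i j => if i = 0 then 0 else A (i - 1) j) ρ := by
  intro p h1 h2
  have hinj : Function.Injective (fun k : ℕ × ℕ => (k.1 + 1, k.2)) := by
    rintro ⟨i, j⟩ ⟨i', j'⟩ h; simpa using h
  rw [← hinj.hasSum_iff]
  · refine HasSum.congr_fun ((hF p h1 h2).mul_left p.1) fun k => ?_
    simp [Function.comp, pow_succ]; ring
  · rintro ⟨i, j⟩ hk
    rcases i with _ | i
    · simp
    · exact absurd ⟨(i, j), rfl⟩ hk

theorem snd_mul (hF : HasDoubleSeries F A ρ) :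
    HasDoubleSeries (fun p => p.2 * F p) (fun i j => if j = 0 then 0 else A i (j - 1)) ρ :=
  hF.swap.fst_mul.swap

/-- Weierstrass' theorem on a disc of radius r with ‖p.1‖ < r < ρ: the norms of the terms at (r,
p.2) are a summable majorant there. -/
theorem hasSum_fst_deriv (hF : HasDoubleSeries F A ρ) {p : ℂ × ℂ} (h1 : ‖p.1‖ < ρ)
    (h2 : ‖p.2‖ < ρ) :
    HasSum (fun k : ℕ × ℕ => A k.1 k.2 * (k.1 * p.1 ^ (k.1 - 1)) * p.2 ^ k.2)
      (deriv (fun s => F (s, p.2)) p.1) := by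
  obtain ⟨r, hr1, hr2⟩ := exists_between h1
  have hr0 : 0 ≤ r := (norm_nonneg _).trans hr1.le
  have hsum := (hF (r, p.2) (by simpa [abs_of_nonneg hr0] using hr2) h2).summable.norm
  have key := Complex.hasSum_deriv_of_summable_norm (U := Metric.ball (0 : ℂ) r)
    (F := fun (k : ℕ × ℕ) (s : ℂ) => A k.1 k.2 * s ^ k.1 * p.2 ^ k.2) (z := p.1) hsum
    (fun k => by fun_prop) Metric.isOpen_ball (fun k w hw => by
      have hw' : ‖w‖ ≤ r := by simpa using (Metric.mem_ball.mp hw).le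
      simp only [norm_mul, norm_pow]
      have : ‖(r : ℂ)‖ = r := by simp [abs_of_nonneg hr0]
      rw [this]
      gcongr) (by simpa using hr1)
  have heq : deriv (fun w : ℂ => ∑' k : ℕ × ℕ, A k.1 k.2 * w ^ k.1 * p.2 ^ k.2) p.1 =
      deriv (fun s => F (s, p.2)) p.1 := by
    apply Filter.EventuallyEq.deriv_eq
    have : ∀ᶠ s in 𝓝 p.1, ‖s‖ < ρ := continuous_norm.continuousAt.eventually_lt_const h1
    filter_upwards [this] with s hs
    exact (hF (s, p.2) hs h2).tsum_eq
  rw [heq] at key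
  refine HasSum.congr_fun key fun k => ?_
  simp

theorem deriv_fst (hF : HasDoubleSeries F A ρ) :
    HasDoubleSeries (fun p => deriv (fun s => F (s, p.2)) p.1)
      (fun i j => ((i : ℂ) + 1) * A (i + 1) j) ρ := by
  intro p h1 h2
  have hinj : Function.Injective (fun k : ℕ × ℕ => (k.1 + 1, k.2)) := by
    rintro ⟨i, j⟩ ⟨i', j'⟩ h; simpa using h
  have := hF.hasSum_fst_deriv h1 h2
  rw [← hinj.hasSum_iff] at this
  · refine HasSum.congr_fun this fun k => ?_
    simp only [Function.comp, Nat.add_sub_cancel, Nat.cast_add, Nat.cast_one]; ring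
  · rintro ⟨i, j⟩ hk
    rcases i with _ | i
    · simp
    · exact absurd ⟨(i, j), rfl⟩ hk

theorem deriv_snd (hF : HasDoubleSeries F A ρ) :
    HasDoubleSeries (fun p => deriv (fun s => F (p.1, s)) p.2)
      (fun i j => ((j : ℂ) + 1) * A i (j + 1)) ρ :=
  hF.swap.deriv_fst.swap

theorem thetaX (hF : HasDoubleSeries F A ρ) :
    HasDoubleSeries (thetaX F) (fun i j => (i : ℂ) * A i j) ρ := by
  refine hF.deriv_fst.fst_mul.congr (fun p _ _ => rfl) ?_
  intro i j
  rcases i with _ | i <;> simp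

theorem thetaY (hF : HasDoubleSeries F A ρ) :
    HasDoubleSeries (thetaY F) (fun i j => (j : ℂ) * A i j) ρ := by
  refine hF.deriv_snd.snd_mul.congr (fun p _ _ => rfl) ?_
  intro i j
  rcases j with _ | j <;> simp

end HasDoubleSeries

theorem eventually_norm_lt {ρ : ℝ} (hρ : 0 < ρ) :
    ∀ᶠ p in 𝓝 ((0, 0) : ℂ × ℂ), ‖p.1‖ < ρ ∧ ‖p.2‖ < ρ := by
  have h1 : ContinuousAt (fun p : ℂ × ℂ => ‖p.1‖) (0, 0) := by fun_prop
  have h2 : ContinuousAt (fun p : ℂ × ℂ => ‖p.2‖) (0, 0) := by fun_prop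
  exact (h1.eventually_lt_const (by simpa using hρ)).and
    (h2.eventually_lt_const (by simpa using hρ))

theorem exists_forall_of_eventually {P : ℂ × ℂ → Prop} (h : ∀ᶠ p in 𝓝 ((0, 0) : ℂ × ℂ), P p) :
    ∃ δ > 0, ∀ p : ℂ × ℂ, ‖p.1‖ < δ → ‖p.2‖ < δ → P p := by
  obtain ⟨δ, hδ, h⟩ := Metric.eventually_nhds_iff.mp h
  refine ⟨δ, hδ, fun p h1 h2 => h ?_⟩
  rw [show ((0, 0) : ℂ × ℂ) = 0 from rfl, dist_zero_right, Prod.norm_def]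
  exact max_lt h1 h2

/-- A power series in one variable vanishing near `0` has zero coefficients. -/
theorem coeff_eq_zero_of_hasSum_zero {α : ℕ → ℂ} {ρ : ℝ} (hρ : 0 < ρ)
    (h : ∀ x : ℂ, ‖x‖ < ρ → HasSum (fun i => α i * x ^ i) 0) (i : ℕ) : α i = 0 := by
  have hf : HasFPowerSeriesAt (fun _ : ℂ => (0 : ℂ)) (FormalMultilinearSeries.ofScalars ℂ α) 0 := by
    rw [hasFPowerSeriesAt_iff]
    have : ∀ᶠ x in 𝓝 (0 : ℂ), ‖x‖ < ρ :=
      continuous_norm.continuousAt.eventually_lt_const (by simpa using hρ)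
    filter_upwards [this] with x hx
    simpa [FormalMultilinearSeries.coeff_ofScalars, mul_comm] using h x hx
  have := hf.eq_zero
  have h2 := congrArg (fun q : FormalMultilinearSeries ℂ ℂ ℂ => q.coeff i) this
  rw [FormalMultilinearSeries.coeff_ofScalars] at h2
  exact h2.trans rfl

namespace HasDoubleSeries

variable {F G : ℂ × ℂ → ℂ} {A B : ℕ → ℕ → ℂ} {ρ : ℝ}

/-- One-variable uniqueness is applied twice: in x for fixed y, which kills each inner sum over j,
and then in y. -/
theorem coeff_eq_zero (hρ : 0 < ρ) (hF : HasDoubleSeries F A ρ)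
    (h0 : ∀ᶠ p in 𝓝 ((0, 0) : ℂ × ℂ), F p = 0) (i j : ℕ) : A i j = 0 := by
  obtain ⟨δ, hδ, h0⟩ := exists_forall_of_eventually h0
  have hF := hF.mono (min_le_left ρ δ)
  have hm : 0 < min ρ δ := lt_min hρ hδ
  have h0 : ∀ p : ℂ × ℂ, ‖p.1‖ < min ρ δ → ‖p.2‖ < min ρ δ → F p = 0 := fun p h1 h2 =>
    h0 p (h1.trans_le (min_le_right _ _)) (h2.trans_le (min_le_right _ _))
  have hfib : ∀ x y : ℂ, ‖x‖ < min ρ δ → ‖y‖ < min ρ δ → ∀ i,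
      Summable (fun j => A i j * x ^ i * y ^ j) := fun x y h1 h2 i =>
    (hF (x, y) h1 h2).summable.prod_factor i
  obtain ⟨r, hr0, hr⟩ := exists_between hm
  have hrn : ‖(r : ℂ)‖ < min ρ δ := by simpa [abs_of_pos hr0] using hr
  -- Convergence at the nonzero point x = r lets the factor x^i be divided out.
  have hfib' : ∀ y : ℂ, ‖y‖ < min ρ δ → ∀ i, Summable (fun j => A i j * y ^ j) := by
    intro y hy i
    have := (hfib r y hrn hy i).mul_left (((r : ℂ) ^ i)⁻¹)
    refine this.congr fun j => ?_
    have : (r : ℂ) ^ i ≠ 0 := pow_ne_zero _ (by exact_mod_cast hr0.ne')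
    field_simp
  refine coeff_eq_zero_of_hasSum_zero (α := fun j => A i j) hm (fun y hy => ?_) j
  have hz : ∑' j, A i j * y ^ j = 0 := by
    refine coeff_eq_zero_of_hasSum_zero (α := fun i => ∑' j, A i j * y ^ j) hm (fun x hx => ?_) i
    have := hF (x, y) hx hy
    rw [h0 (x, y) hx hy] at this
    refine this.prod_fiberwise fun i => ?_
    have h3 := (hfib' y hy i).hasSum.mul_right (x ^ i)
    refine HasSum.congr_fun h3 fun j => ?_
    ring
  simpa [hz] using (hfib' y hy i).hasSum

theorem eq_zero_of_coeff (hF : HasDoubleSeries F A ρ) (hA : ∀ i j, A i j = 0) {p : ℂ × ℂ}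
    (h1 : ‖p.1‖ < ρ) (h2 : ‖p.2‖ < ρ) : F p = 0 := by
  have := hF p h1 h2
  simp only [hA, zero_mul] at this
  exact this.unique hasSum_zero

end HasDoubleSeries

/-! ### Double power series versus analyticity at the origin. -/

theorem summable_double_of_bound {A : ℕ → ℕ → ℂ} {C K L : ℝ} (hK : 0 < K) (hL : 0 < L)
    (hA : ∀ i j, ‖A i j‖ ≤ C * (K ^ i * L ^ j)) {x y : ℂ} (hx : ‖x‖ < K⁻¹) (hy : ‖y‖ < L⁻¹) :
    Summable (fun k : ℕ × ℕ => A k.1 k.2 * x ^ k.1 * y ^ k.2) := by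
  have h1 : ∀ {M : ℝ} (_ : 0 < M) {t : ℂ}, ‖t‖ < M⁻¹ → Summable (fun n : ℕ => (M * ‖t‖) ^ n) := by
    intro M hM t ht
    refine summable_geometric_of_lt_one (by positivity) ?_
    rw [mul_comm]
    exact (lt_inv_mul_iff₀' hM).mp (by simpa using ht)
  have hs := ((h1 hK hx).mul_of_nonneg (h1 hL hy) (fun n => by positivity)
    (fun n => by positivity)).mul_left C
  refine Summable.of_norm_bounded hs fun k => ?_
  rw [norm_mul, norm_mul, norm_pow, norm_pow, mul_pow, mul_pow]
  calc ‖A k.1 k.2‖ * ‖x‖ ^ k.1 * ‖y‖ ^ k.2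
      ≤ (C * (K ^ k.1 * L ^ k.2)) * ‖x‖ ^ k.1 * ‖y‖ ^ k.2 := by gcongr; exact hA _ _
    _ = _ := by ring

theorem HasSum.antidiagonal {E : Type*} [NormedAddCommGroup E] {f : ℕ × ℕ → E} {a : E}
    (h : HasSum f a) :
    HasSum (fun n => ∑ k ∈ Finset.HasAntidiagonal.antidiagonal n, f k) a := by
  rw [← Finset.HasAntidiagonal.sigmaAntidiagonalEquivProd.hasSum_iff] at h
  refine HasSum.congr_fun (h.sigma fun n => hasSum_fintype _) fun n => ?_
  exact (Finset.sum_coe_sort (Finset.HasAntidiagonal.antidiagonal n) f).symm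

/-- The multilinear map `v ↦ ∏_{l < i} (v l).1 * ∏_{l ≥ i} (v l).2`. -/
noncomputable def monomialMultilinear (n i : ℕ) :
    ContinuousMultilinearMap ℂ (fun _ : Fin n => ℂ × ℂ) ℂ :=
  (ContinuousMultilinearMap.mkPiAlgebra ℂ (Fin n) ℂ).compContinuousLinearMap
    (fun l => if (l : ℕ) < i then ContinuousLinearMap.fst ℂ ℂ ℂ else ContinuousLinearMap.snd ℂ ℂ ℂ)

theorem norm_monomialMultilinear_le (n i : ℕ) : ‖monomialMultilinear n i‖ ≤ 1 := by
  refine (ContinuousMultilinearMap.norm_compContinuousLinearMap_le _ _).trans ?_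
  rw [ContinuousMultilinearMap.norm_mkPiAlgebra, one_mul]
  refine Finset.prod_le_one (fun _ _ => norm_nonneg _) fun l _ => ?_
  split_ifs
  · exact ContinuousLinearMap.norm_fst_le ..
  · exact ContinuousLinearMap.norm_snd_le ..

theorem monomialMultilinear_apply (i j : ℕ) (p : ℂ × ℂ) :
    monomialMultilinear (i + j) i (fun _ => p) = p.1 ^ i * p.2 ^ j := by
  have : monomialMultilinear (i + j) i (fun _ => p) =
      ∏ l : Fin (i + j), (fun l : ℕ => if l < i then p.1 else p.2) l := by
    simp only [monomialMultilinear, ContinuousMultilinearMap.compContinuousLinearMap_apply,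
      ContinuousMultilinearMap.mkPiAlgebra_apply]
    refine Finset.prod_congr rfl fun l _ => ?_
    split_ifs <;> simp
  rw [this, Fin.prod_univ_eq_prod_range (fun l : ℕ => if l < i then p.1 else p.2),
    Finset.prod_range_add]
  congr 1
  · rw [Finset.prod_congr rfl (g := fun _ => p.1)]
    · simp
    · intro l hl; simp [Finset.mem_range.mp hl]
  · simp

/-- Terms are grouped by total degree n, each monomial being the diagonal of a multilinear map of
norm at most 1. The radius is then at least any r < ρ. -/
theorem HasDoubleSeries.analyticAt {F : ℂ × ℂ → ℂ} {A : ℕ → ℕ → ℂ} {ρ : ℝ} (hρ : 0 < ρ)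
    (hF : HasDoubleSeries F A ρ) : AnalyticAt ℂ F (0, 0) := by
  obtain ⟨r, hr0, hr⟩ := exists_between hρ
  have hrn : ‖(r : ℂ)‖ = r := by simp [abs_of_pos hr0]
  let q : FormalMultilinearSeries ℂ (ℂ × ℂ) ℂ := fun n =>
    ∑ k ∈ Finset.HasAntidiagonal.antidiagonal n, A k.1 k.2 • monomialMultilinear n k.1
  have hq : ∀ n (p : ℂ × ℂ), q n (fun _ => p) =
      ∑ k ∈ Finset.HasAntidiagonal.antidiagonal n, A k.1 k.2 * p.1 ^ k.1 * p.2 ^ k.2 := by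
    intro n p
    simp only [q, sum_apply, smul_apply]
    refine Finset.sum_congr rfl fun k hk => ?_
    obtain rfl := Finset.HasAntidiagonal.mem_antidiagonal.mp hk
    rw [monomialMultilinear_apply, smul_eq_mul, mul_assoc]
  have hsn := (hF (r, r) (by rwa [hrn]) (by rwa [hrn])).summable.norm
  have hs2 : Summable fun n => ∑ k ∈ Finset.HasAntidiagonal.antidiagonal n,
      ‖A k.1 k.2 * (r : ℂ) ^ k.1 * (r : ℂ) ^ k.2‖ :=
    hsn.hasSum.antidiagonal.summable
  have hrad : (r.toNNReal : ENNReal) ≤ q.radius := by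
    refine q.le_radius_of_summable (hs2.of_nonneg_of_le (fun n => by positivity) fun n => ?_)
    rw [Real.coe_toNNReal _ hr0.le]
    refine (mul_le_mul_of_nonneg_right (norm_sum_le _ _) (by positivity)).trans ?_
    rw [Finset.sum_mul]
    refine Finset.sum_le_sum fun k hk => ?_
    obtain rfl := Finset.HasAntidiagonal.mem_antidiagonal.mp hk
    rw [norm_smul, norm_mul, norm_mul, norm_pow, norm_pow, hrn, pow_add, ← mul_assoc]
    gcongr
    exact mul_le_of_le_one_right (norm_nonneg _) (norm_monomialMultilinear_le _ _)
  refine ⟨q, r.toNNReal, hrad, by simpa using hr0, fun {p} hp => ?_⟩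
  have hp' : ‖p‖ < r := by
    simpa [Metric.eball_coe, Real.coe_toNNReal _ hr0.le] using hp
  have h1 : ‖p.1‖ < ρ := (norm_fst_le p).trans_lt (hp'.trans hr)
  have h2 : ‖p.2‖ < ρ := (norm_snd_le p).trans_lt (hp'.trans hr)
  have h := hF p h1 h2
  rw [show ((0, 0) : ℂ × ℂ) + p = p from zero_add p]
  exact HasSum.congr_fun h.antidiagonal fun n => hq n p

/-- Coefficients of the double series attached to a formal multilinear series on `ℂ × ℂ`. -/
noncomputable def doubleCoeff (q : FormalMultilinearSeries ℂ (ℂ × ℂ) ℂ) (n i : ℕ) : ℂ :=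
  ∑ s : Finset (Fin n) with s.card = i, q n (s.piecewise (fun _ => (1, 0)) (fun _ => (0, 1)))

theorem norm_doubleCoeff_le (q : FormalMultilinearSeries ℂ (ℂ × ℂ) ℂ) (n i : ℕ) :
    ‖doubleCoeff q n i‖ ≤ 2 ^ n * ‖q n‖ := by
  have h : ∀ s : Finset (Fin n),
      ‖q n (s.piecewise (fun _ => (1, 0)) (fun _ => (0, 1)))‖ ≤ ‖q n‖ := by
    intro s
    refine (ContinuousMultilinearMap.le_opNorm _ _).trans
      (mul_le_of_le_one_right (norm_nonneg _) ?_)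
    refine Finset.prod_le_one (fun _ _ => norm_nonneg _) fun l _ => ?_
    by_cases hl : l ∈ s <;> simp [hl, Prod.norm_def]
  calc ‖doubleCoeff q n i‖ ≤ ∑ s : Finset (Fin n) with s.card = i, ‖q n‖ :=
        norm_sum_le_of_le _ fun s _ => h s
    _ ≤ ∑ s : Finset (Fin n), ‖q n‖ :=
        Finset.sum_le_sum_of_subset_of_nonneg (Finset.filter_subset _ _)
          fun _ _ _ => norm_nonneg _
    _ = 2 ^ n * ‖q n‖ := by simp

/-- Expand q n at p = p.1 (1, 0) + p.2 (0, 1) by multilinearity; the subset s of slots filled with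
(1, 0) contributes to the monomial of x-degree `s.card`. -/
theorem sum_doubleCoeff (q : FormalMultilinearSeries ℂ (ℂ × ℂ) ℂ) (n : ℕ) (p : ℂ × ℂ) :
    ∑ k ∈ Finset.HasAntidiagonal.antidiagonal n, doubleCoeff q (k.1 + k.2) k.1 * p.1 ^ k.1 * p.2 ^ k.2 =
      q n (fun _ => p) := by
  have hp : (fun _ : Fin n => p) =
      (fun _ => p.1 • ((1, 0) : ℂ × ℂ)) + (fun _ => p.2 • ((0, 1) : ℂ × ℂ)) := by
    ext <;> simp
  have hterm : ∀ s : Finset (Fin n),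
      q n (s.piecewise (fun _ => p.1 • ((1, 0) : ℂ × ℂ)) (fun _ => p.2 • ((0, 1) : ℂ × ℂ))) =
        q n (s.piecewise (fun _ => (1, 0)) (fun _ => (0, 1))) * p.1 ^ s.card *
          p.2 ^ (n - s.card) := by
    intro s
    have : (s.piecewise (fun _ => p.1 • ((1, 0) : ℂ × ℂ)) (fun _ => p.2 • ((0, 1) : ℂ × ℂ))) =
        fun l => (s.piecewise (fun _ => p.1) (fun _ => p.2) l : ℂ) •
          (s.piecewise (fun _ => (1, 0)) (fun _ => (0, 1)) l : ℂ × ℂ) := by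
      ext l <;> by_cases hl : l ∈ s <;> simp [hl]
    rw [this, ContinuousMultilinearMap.map_smul_univ, Finset.prod_piecewise, smul_eq_mul]
    simp only [Finset.prod_const, Finset.univ_inter]
    rw [← Finset.compl_eq_univ_sdiff, Finset.card_compl, Fintype.card_fin]
    ring
  rw [hp, ContinuousMultilinearMap.map_add_univ, Finset.sum_congr rfl fun s _ => hterm s,
    Finset.Nat.sum_antidiagonal_eq_sum_range_succ_mk,
    ← Finset.sum_fiberwise_of_maps_to (s := Finset.univ) (t := Finset.range (n + 1))
      (g := fun s : Finset (Fin n) => s.card)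
      (fun s _ => Finset.mem_range.mpr (Nat.lt_succ_of_le (by simpa using s.card_le_univ)))]
  refine Finset.sum_congr rfl fun i hi => ?_
  have hi' : i + (n - i) = n := Nat.add_sub_cancel' (Nat.le_of_lt_succ (Finset.mem_range.mp hi))
  simp only [hi']
  rw [doubleCoeff, Finset.sum_mul, Finset.sum_mul]
  refine Finset.sum_congr rfl fun s hs => ?_
  rw [(Finset.mem_filter.mp hs).2]

theorem AnalyticAt.exists_hasDoubleSeries {F : ℂ × ℂ → ℂ} (hF : AnalyticAt ℂ F (0, 0)) :
    ∃ A ρ, 0 < ρ ∧ HasDoubleSeries F A ρ := by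
  obtain ⟨q, r, hq⟩ := hF
  obtain ⟨C, a, hC, ha, hb⟩ := q.le_mul_pow_of_radius_pos (hq.r_pos.trans_le hq.r_le)
  obtain ⟨δ, hδ, hδF⟩ := exists_forall_of_eventually
    (P := fun p => HasSum (fun n : ℕ => q n fun _ : Fin n => p) (F p)) (by
      have := hq.hasFPowerSeriesAt.eventually_hasSum
      simpa only [show ((0, 0) : ℂ × ℂ) = 0 from rfl, zero_add] using this)
  -- The 2 in 2a pays for the at most 2^n subsets of slots summed in one coefficient of degree n.
  refine ⟨fun i j => doubleCoeff q (i + j) i, min δ (2 * a)⁻¹, by positivity, fun p h1 h2 => ?_⟩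
  have hs : Summable (fun k : ℕ × ℕ =>
      doubleCoeff q (k.1 + k.2) k.1 * p.1 ^ k.1 * p.2 ^ k.2) := by
    refine summable_double_of_bound (A := fun i j => doubleCoeff q (i + j) i) (C := C)
      (K := 2 * a) (L := 2 * a) (by positivity) (by positivity) (fun i j => ?_)
      (h1.trans_le (min_le_right _ _)) (h2.trans_le (min_le_right _ _))
    refine (norm_doubleCoeff_le q _ _).trans ?_
    rw [← pow_add, mul_pow]
    calc (2 : ℝ) ^ (i + j) * ‖q (i + j)‖ ≤ 2 ^ (i + j) * (C * a ^ (i + j)) := by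
          gcongr; exact hb _
      _ = _ := by ring
  have h := hs.hasSum
  have h4 := hδF p (h1.trans_le (min_le_left _ _)) (h2.trans_le (min_le_left _ _))
  have h5 : HasSum (fun n : ℕ => q n fun _ : Fin n => p) _ :=
    HasSum.congr_fun h.antidiagonal fun n => (sum_doubleCoeff q n p).symm
  rw [h4.unique h5]
  exact h

/-! ### The differential system as recursions on coefficient arrays. -/

/-- The coefficients of `x * F` in terms of those of `F`. -/
def shiftX (A : ℕ → ℕ → ℂ) (i j : ℕ) : ℂ := if i = 0 then 0 else A (i - 1) j

/-- The coefficients of `y * F` in terms of those of `F`. -/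
def shiftY (A : ℕ → ℕ → ℂ) (i j : ℕ) : ℂ := if j = 0 then 0 else A i (j - 1)

@[simp] theorem shiftX_zero (A : ℕ → ℕ → ℂ) (j : ℕ) : shiftX A 0 j = 0 := rfl

@[simp] theorem shiftX_succ (A : ℕ → ℕ → ℂ) (i j : ℕ) : shiftX A (i + 1) j = A i j := rfl

@[simp] theorem shiftY_zero (A : ℕ → ℕ → ℂ) (i : ℕ) : shiftY A i 0 = 0 := rfl

@[simp] theorem shiftY_succ (A : ℕ → ℕ → ℂ) (i j : ℕ) : shiftY A i (j + 1) = A i j := rfl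

/-- The action of `pdeOp₁` on coefficients. -/
noncomputable def pdeCoeff₁ (a b c : ℂ) (A : ℕ → ℕ → ℂ) (i j : ℕ) : ℂ :=
  (i : ℂ) * (i - 2 * j) * A i j
    - shiftX (fun i j => (a * i ^ 2 + a * i + b) * A i j) i j
    + c * shiftX (shiftX fun i j => ((i : ℂ) + 1) ^ 2 * A i j + ((i : ℂ) + 1) *
        (shiftY (fun i j => (4 * (i : ℂ) - 8 * j) * A i j) i j + 2 * j * A i j)) i j

/-- The action of `pdeOp₂` on coefficients. -/
noncomputable def pdeCoeff₂ (A : ℕ → ℕ → ℂ) (i j : ℕ) : ℂ :=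
  (j : ℂ) ^ 2 * A i j - shiftY (fun i j => (2 * (j : ℂ) - i + 1) * (2 * j - i) * A i j) i j

namespace HasDoubleSeries

variable {F : ℂ × ℂ → ℂ} {A : ℕ → ℕ → ℂ} {ρ : ℝ}

theorem pdeOp₁ (a b c : ℂ) (hF : HasDoubleSeries F A ρ) :
    HasDoubleSeries (pdeOp₁ a b c F) (pdeCoeff₁ a b c A) ρ := by
  have hX := hF.thetaX
  have hY := hF.thetaY
  have h1 := (hX.sub (hY.const_mul 2)).thetaX
  have h2 := (((hX.thetaX.const_mul a).add (hX.const_mul a)).add (hF.const_mul b)).fst_mul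
  have h3 := (hX.add hF).thetaX.add (hX.add hF)
  have h4 : HasDoubleSeries
      (fun q => 4 * q.2 * _root_.thetaX F q + (2 - 8 * q.2) * _root_.thetaY F q)
      (fun i j => shiftY (fun i j => (4 * (i : ℂ) - 8 * j) * A i j) i j + 2 * j * A i j) ρ := by
    refine (((hX.const_mul 4).sub (hY.const_mul 8)).snd_mul.add (hY.const_mul 2)).congr
      (fun p _ _ => by ring) (fun i j => ?_)
    rcases j with _ | j <;> simp <;> ring
  have h5 := (h3.add (h4.thetaX.add h4)).fst_mul.fst_mul.const_mul c
  refine ((h1.sub h2).add h5).congr (fun p _ _ => ?_) fun i j => ?_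
  · simp only [_root_.pdeOp₁]; ring
  · rcases i with _ | _ | i <;> simp [pdeCoeff₁] <;> ring

theorem pdeOp₂ (hF : HasDoubleSeries F A ρ) :
    HasDoubleSeries (pdeOp₂ F) (pdeCoeff₂ A) ρ := by
  have hX := hF.thetaX
  have hY := hF.thetaY
  have h1 := (hY.const_mul 2).sub hX
  have h2 := (((h1.thetaY.const_mul 2).sub h1.thetaX).add h1).snd_mul
  refine (hY.thetaY.sub h2).congr (fun p _ _ => ?_) fun i j => ?_
  · simp only [_root_.pdeOp₂]
  · rcases j with _ | j <;> simp [pdeCoeff₂] <;> ring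

end HasDoubleSeries

/-- A coefficient array killed by both operators is determined by its value at `(0, 0)`. -/
theorem eq_zero_of_pdeCoeff {a b c : ℂ} {A : ℕ → ℕ → ℂ} (h00 : A 0 0 = 0)
    (h1 : ∀ i j, pdeCoeff₁ a b c A i j = 0) (h2 : ∀ i j, pdeCoeff₂ A i j = 0) (i j : ℕ) :
    A i j = 0 := by
  -- At j = 0 the leading factor i(i - 2j) is i² and the `shiftY` term vanishes, so the first
  -- equation is a three-term recursion within this row.
  have hrow : ∀ i, A i 0 = 0 := by
    intro i
    induction i using Nat.strong_induction_on with
    | _ i ih =>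
      have h := h1 i 0
      rcases i with _ | _ | i
      · exact h00
      · simpa [pdeCoeff₁, h00] using h
      · have e1 := ih (i + 1) (by omega)
        have e2 := ih i (by omega)
        simp [pdeCoeff₁, e1, e2] at h
        rcases h with h | h
        · exact absurd h (by exact_mod_cast Nat.succ_ne_zero (i + 1))
        · exact h
  induction j with
  | zero => exact hrow i
  | succ j ih =>
    -- The second equation gives (j + 1)² A i (j + 1) as a multiple of A i j.
    have h := h2 i (j + 1)
    simp [pdeCoeff₂, ih] at h
    rcases h with h | h
    · exact absurd h (by exact_mod_cast Nat.succ_ne_zero j)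
    · exact h

/-! ### Binomial identities, growth bounds, and S as the unique normalized solution. -/

/-- The number `C(n, 2m) C(2m, m)`. -/
noncomputable def trinomialCoeff (n m : ℕ) : ℂ := ((2 * m).choose m : ℂ) * (n.choose (2 * m) : ℂ)

theorem choose_succ_mul_cast (n k : ℕ) :
    (n.choose (k + 1) : ℂ) * (k + 1) = n.choose k * ((n : ℂ) - k) := by
  rcases le_or_gt k n with h | h
  · have := Nat.choose_succ_right_eq n k
    rw [← Nat.cast_sub h]
    exact_mod_cast this
  · simp [Nat.choose_eq_zero_of_lt h, Nat.choose_eq_zero_of_lt (h.trans (Nat.lt_succ_self k))]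

theorem trinomialCoeff_zero (n : ℕ) : trinomialCoeff n 0 = 1 := by simp [trinomialCoeff]

theorem trinomialCoeff_succ_right (n m : ℕ) :
    ((m : ℂ) + 1) ^ 2 * trinomialCoeff n (m + 1) =
      ((n : ℂ) - 2 * m) * (n - 2 * m - 1) * trinomialCoeff n m := by
  have h1 := choose_succ_mul_cast n (2 * m)
  have h2 := choose_succ_mul_cast n (2 * m + 1)
  have h3 : ((m : ℂ) + 1) * ((2 * (m + 1)).choose (m + 1) : ℂ) =
      2 * (2 * m + 1) * ((2 * m).choose m : ℂ) := by
    have := Nat.succ_mul_centralBinom_succ m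
    simp only [Nat.centralBinom] at this
    exact_mod_cast this
  push_cast at h1 h2
  rw [trinomialCoeff, trinomialCoeff, show 2 * (m + 1) = 2 * m + 1 + 1 by ring] at *
  linear_combination ((m : ℂ) + 1) * (n.choose (2 * m + 1 + 1) : ℂ) * h3 +
    (2 * m + 1) * ((2 * m).choose m : ℂ) * h2 + (n - 2 * m - 1) * ((2 * m).choose m : ℂ) * h1

theorem trinomialCoeff_succ_left (n m : ℕ) :
    ((n : ℂ) + 1 - 2 * m) * trinomialCoeff (n + 1) m = ((n : ℂ) + 1) * trinomialCoeff n m := by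
  have h : ((n + 1).choose (2 * m) : ℂ) * ((n : ℂ) + 1 - 2 * m) =
      n.choose (2 * m) * ((n : ℂ) + 1) := by
    have h1 := choose_succ_mul_cast (n + 1) (2 * m)
    have h2 : ((n : ℂ) + 1) * n.choose (2 * m) = (n + 1).choose (2 * m + 1) * (2 * m + 1) := by
      exact_mod_cast Nat.add_one_mul_choose_eq n (2 * m)
    push_cast at h1
    linear_combination -h1 - h2
  rw [trinomialCoeff, trinomialCoeff]
  linear_combination ((2 * m).choose m : ℂ) * h

/-- The right side is the bracket that multiplies c(n + 1) u_n in the first equation. After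
multiplication by m², everything for m ≥ 1 reduces to t(n, m - 1). -/
theorem trinomialCoeff_succ_left_eq (n m : ℕ) :
    ((n : ℂ) + 1) * trinomialCoeff (n + 1) m = ((n : ℂ) + 1 + 2 * m) * trinomialCoeff n m +
      shiftY (fun i j => (4 * (i : ℂ) - 8 * j) * trinomialCoeff i j) n m := by
  rcases m with _ | k
  · simp [trinomialCoeff_zero]
  · have hk : ((k : ℂ) + 1) ^ 2 ≠ 0 := pow_ne_zero _ (by exact_mod_cast Nat.succ_ne_zero k)
    apply mul_left_cancel₀ hk
    have h1 := trinomialCoeff_succ_right n k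
    have h2 := trinomialCoeff_succ_right (n + 1) k
    have h3 := trinomialCoeff_succ_left n k
    push_cast at h2 ⊢
    simp only [shiftY_succ]
    linear_combination ((n : ℂ) + 1) * h2 + (n + 1) * (n - 2 * k) * h3
      - (n + 1 + 2 * (k + 1)) * h1

/-- The coefficients of the two-variable series. -/
noncomputable def wzCoeff (u : ℕ → ℂ) (n m : ℕ) : ℂ := u n * trinomialCoeff n m

theorem pdeCoeff₂_wzCoeff (u : ℕ → ℂ) (n m : ℕ) : pdeCoeff₂ (wzCoeff u) n m = 0 := by
  rcases m with _ | m
  · simp [pdeCoeff₂]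
  · have := trinomialCoeff_succ_right n m
    simp only [pdeCoeff₂, shiftY_succ, wzCoeff]
    push_cast
    linear_combination u n * this

/-- The two identities for t in n turn all three groups of terms into multiples of t(n, m), where n
+ 1 is the x-degree; the cofactor is the Apéry recursion at n. -/
theorem pdeCoeff₁_wzCoeff (a b c : ℂ) (n m : ℕ) :
    pdeCoeff₁ a b c (wzCoeff (aperySeq a b c)) n m = 0 := by
  rcases n with _ | n
  · simp [pdeCoeff₁]
  have h1 := trinomialCoeff_succ_left n m
  have h2 := aperySeq_rec a b c n
  rcases n with _ | n
  · simp [pdeCoeff₁, wzCoeff] at h1 h2 ⊢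
    linear_combination aperySeq a b c 1 * h1 + trinomialCoeff 0 m * h2
  · have h3 := trinomialCoeff_succ_left_eq n m
    have h4 : shiftY (fun i j => (4 * (i : ℂ) - 8 * j) * (aperySeq a b c i * trinomialCoeff i j)) n m
        = aperySeq a b c n *
          shiftY (fun i j => (4 * (i : ℂ) - 8 * j) * trinomialCoeff i j) n m := by
      rcases m with _ | m
      · simp
      · simp only [shiftY_succ]; ring
    simp only [pdeCoeff₁, wzCoeff, shiftX_succ, h4]
    push_cast at h1 h2 h3 ⊢
    linear_combination ((n : ℂ) + 1 + 1) * aperySeq a b c (n + 1 + 1) * h1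
      + trinomialCoeff (n + 1) m * h2
      - c * ((n : ℂ) + 1) * aperySeq a b c n * h3

theorem norm_trinomialCoeff_le (n m : ℕ) : ‖trinomialCoeff n m‖ ≤ 2 ^ n * 4 ^ m := by
  have h1 : (((2 * m).choose m : ℕ) : ℝ) ≤ 4 ^ m := by
    have := Nat.choose_le_two_pow (2 * m) m
    rw [pow_mul] at this
    exact_mod_cast this
  have h2 : ((n.choose (2 * m) : ℕ) : ℝ) ≤ 2 ^ n := by
    exact_mod_cast Nat.choose_le_two_pow n (2 * m)
  rw [trinomialCoeff, norm_mul, Complex.norm_natCast, Complex.norm_natCast, mul_comm]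
  gcongr

theorem exists_norm_aperySeq_le (a b c : ℂ) : ∃ K : ℝ, 1 ≤ K ∧ ∀ n, ‖aperySeq a b c n‖ ≤ K ^ n := by
  -- Inserting K^(n+1) for both earlier terms, the recursion needs ‖a‖((n+1)² + (n+1)) + ‖b‖ +
  -- ‖c‖(n+1)² ≤ K(n+2)²; K ≥ 1 allows the older term to be so bounded.
  set K : ℝ := 1 + 2 * ‖a‖ + ‖b‖ + ‖c‖ with hK
  have hK1 : 1 ≤ K := by rw [hK]; linarith [norm_nonneg a, norm_nonneg b, norm_nonneg c]
  refine ⟨K, hK1, fun n => ?_⟩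
  induction n using Nat.strong_induction_on with
  | _ n ih =>
    rcases n with _ | _ | n
    · simp [aperySeq]
    · simp only [aperySeq, zero_add, pow_one]
      rw [hK]; linarith [norm_nonneg a, norm_nonneg b, norm_nonneg c]
    · have i1 := ih (n + 1) (by omega)
      have i0 : ‖aperySeq a b c n‖ ≤ K ^ (n + 1) :=
        (ih n (by omega)).trans (pow_le_pow_right₀ hK1 (Nat.le_succ n))
      have hn : ‖(n : ℂ) + 1‖ = (n : ℝ) + 1 := by
        rw [← Nat.cast_add_one, Complex.norm_natCast]; push_cast; ring
      have hn2 : ‖(n : ℂ) + 2‖ = (n : ℝ) + 2 := by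
        rw [show (n : ℂ) + 2 = ((n + 2 : ℕ) : ℂ) by push_cast; ring, Complex.norm_natCast]
        push_cast; ring
      have hn0 : (0 : ℝ) ≤ n := Nat.cast_nonneg n
      have hP : 0 ≤ K ^ (n + 1) := by positivity
      rw [aperySeq, norm_div, norm_pow, hn2, div_le_iff₀ (by positivity)]
      have e1 : ‖a * ((n : ℂ) + 1) ^ 2 + a * ((n : ℂ) + 1) + b‖ ≤
          ‖a‖ * ((n : ℝ) + 1) ^ 2 + ‖a‖ * ((n : ℝ) + 1) + ‖b‖ := by
        refine (norm_add₃_le).trans (le_of_eq ?_)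
        rw [norm_mul, norm_mul, norm_pow, hn]
      have e2 : ‖c * ((n : ℂ) + 1) ^ 2‖ = ‖c‖ * ((n : ℝ) + 1) ^ 2 := by
        rw [norm_mul, norm_pow, hn]
      calc _ ≤ (‖a‖ * ((n : ℝ) + 1) ^ 2 + ‖a‖ * ((n : ℝ) + 1) + ‖b‖) * K ^ (n + 1) +
            ‖c‖ * ((n : ℝ) + 1) ^ 2 * K ^ (n + 1) := by
            refine (norm_sub_le _ _).trans ?_
            rw [norm_mul, norm_mul (c * _), e2]
            gcongr
        _ = (‖a‖ * ((n : ℝ) + 1) ^ 2 + ‖a‖ * ((n : ℝ) + 1) + ‖b‖ + ‖c‖ * ((n : ℝ) + 1) ^ 2) *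
            K ^ (n + 1) := by ring
        _ ≤ (K * ((n : ℝ) + 2) ^ 2) * K ^ (n + 1) := by
            gcongr
            rw [hK]
            nlinarith [norm_nonneg a, norm_nonneg b, norm_nonneg c,
              mul_nonneg (norm_nonneg a) hn0, mul_nonneg (norm_nonneg b) hn0,
              mul_nonneg (norm_nonneg c) hn0, mul_nonneg (norm_nonneg a) (sq_nonneg (n : ℝ)),
              mul_nonneg (norm_nonneg b) (sq_nonneg (n : ℝ)),
              mul_nonneg (norm_nonneg c) (sq_nonneg (n : ℝ)), sq_nonneg (n : ℝ)]
        _ = K ^ (n + 1 + 1) * ((n : ℝ) + 2) ^ 2 := by ring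

theorem trinomialCoeff_eq_zero {n m : ℕ} (h : n < 2 * m) : trinomialCoeff n m = 0 := by
  simp [trinomialCoeff, Nat.choose_eq_zero_of_lt h]

theorem hasSum_wzTerm {u : ℕ → ℂ} {x y s : ℂ}
    (h : HasSum (fun k : ℕ × ℕ => wzCoeff u k.1 k.2 * x ^ k.1 * y ^ k.2) s) :
    HasSum (wzTerm u x y) s := by
  refine h.prod_fiberwise fun n => ?_
  have : wzTerm u x y n = ∑ m ∈ Finset.range (n / 2 + 1), wzCoeff u n m * x ^ n * y ^ m := by
    rw [wzTerm, Finset.mul_sum]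
    refine Finset.sum_congr rfl fun m _ => ?_
    rw [wzCoeff, trinomialCoeff]; ring
  rw [this]
  refine hasSum_sum_of_ne_finset_zero fun m hm => ?_
  rw [Finset.mem_range, not_lt] at hm
  rw [wzCoeff, trinomialCoeff_eq_zero (by omega)]
  simp

theorem exists_hasDoubleSeries_wzSeries (a b c : ℂ) :
    ∃ ρ > 0, HasDoubleSeries (wzSeries (aperySeq a b c)) (wzCoeff (aperySeq a b c)) ρ ∧
      ∀ p : ℂ × ℂ, ‖p.1‖ < ρ → ‖p.2‖ < ρ → Summable (wzTerm (aperySeq a b c) p.1 p.2) := by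
  obtain ⟨K, hK1, hK⟩ := exists_norm_aperySeq_le a b c
  have hK0 : 0 < K := by linarith
  have hs : ∀ p : ℂ × ℂ, ‖p.1‖ < min (K * 2)⁻¹ 4⁻¹ → ‖p.2‖ < min (K * 2)⁻¹ 4⁻¹ →
      Summable (fun k : ℕ × ℕ => wzCoeff (aperySeq a b c) k.1 k.2 * p.1 ^ k.1 * p.2 ^ k.2) := by
    intro p h1 h2
    refine summable_double_of_bound (C := 1) (K := K * 2) (L := 4) (by positivity) (by norm_num)
      (fun n m => ?_) (h1.trans_le (min_le_left _ _)) (h2.trans_le (min_le_right _ _))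
    rw [wzCoeff, norm_mul, one_mul, mul_pow, mul_assoc]
    exact mul_le_mul (hK n) (norm_trinomialCoeff_le n m) (norm_nonneg _) (by positivity)
  refine ⟨min (K * 2)⁻¹ 4⁻¹, by positivity, fun p h1 h2 => ?_,
    fun p h1 h2 => (hasSum_wzTerm (hs p h1 h2).hasSum).summable⟩
  rw [wzSeries, (hasSum_wzTerm (hs p h1 h2).hasSum).tsum_eq]
  exact (hs p h1 h2).hasSum

theorem isHolSolution_wzSeries (a b c : ℂ) : IsHolSolution a b c (wzSeries (aperySeq a b c)) := by
  obtain ⟨ρ, hρ, h, -⟩ := exists_hasDoubleSeries_wzSeries a b c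
  refine ⟨h.analyticAt hρ, ?_⟩
  filter_upwards [eventually_norm_lt hρ] with p hp
  exact ⟨(h.pdeOp₁ a b c).eq_zero_of_coeff (pdeCoeff₁_wzCoeff a b c) hp.1 hp.2,
    h.pdeOp₂.eq_zero_of_coeff (pdeCoeff₂_wzCoeff _) hp.1 hp.2⟩

/-- By linearity, F - F(0, 0) S solves the system with zero constant term, so all its coefficients
vanish. Here F(0, 0) appears as `A 0 0`. -/
theorem IsHolSolution.eq_const_mul {a b c : ℂ} {F : ℂ × ℂ → ℂ} (hF : IsHolSolution a b c F) :
    ∃ k : ℂ, F =ᶠ[𝓝 ((0, 0) : ℂ × ℂ)] fun p => k * wzSeries (aperySeq a b c) p := by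
  obtain ⟨ρ, hρ, hS, -⟩ := exists_hasDoubleSeries_wzSeries a b c
  obtain ⟨A, ρ', hρ', hA⟩ := hF.1.exists_hasDoubleSeries
  have hm : 0 < min ρ ρ' := lt_min hρ hρ'
  have e1 := (hA.pdeOp₁ a b c).coeff_eq_zero hρ' (hF.2.mono fun p hp => hp.1)
  have e2 := hA.pdeOp₂.coeff_eq_zero hρ' (hF.2.mono fun p hp => hp.2)
  have hD := (hA.mono (min_le_right ρ ρ')).sub
    ((hS.mono (min_le_left ρ ρ')).const_mul (A 0 0))
  have hlin₁ : ∀ i j, pdeCoeff₁ a b c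
      (fun i j => A i j - A 0 0 * wzCoeff (aperySeq a b c) i j) i j = 0 := by
    intro i j
    have h1 := e1 i j
    have h2 := pdeCoeff₁_wzCoeff a b c i j
    rcases i with _ | _ | i <;> rcases j with _ | j <;> simp [pdeCoeff₁] at h1 h2 ⊢ <;>
      linear_combination h1 - A 0 0 * h2
  have hlin₂ : ∀ i j, pdeCoeff₂
      (fun i j => A i j - A 0 0 * wzCoeff (aperySeq a b c) i j) i j = 0 := by
    intro i j
    have h1 := e2 i j
    have h2 := pdeCoeff₂_wzCoeff (aperySeq a b c) i j
    rcases j with _ | j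
    · simp [pdeCoeff₂]
    · simp only [pdeCoeff₂, shiftY_succ] at h1 h2 ⊢
      linear_combination h1 - A 0 0 * h2
  refine ⟨A 0 0, ?_⟩
  filter_upwards [eventually_norm_lt hm] with p hp
  exact sub_eq_zero.mp (hD.eq_zero_of_coeff (eq_zero_of_pdeCoeff
    (by simp [wzCoeff, aperySeq, trinomialCoeff_zero]) hlin₁ hlin₂) hp.1 hp.2)

/-! ### The series in the regular coordinates x and z = x² y. -/

/-- The coefficient of `x^j z^m`, `z = x² y`, in the two-variable series. -/
noncomputable def regCoeff (u : ℕ → ℂ) (j m : ℕ) : ℂ := wzCoeff u (j + 2 * m) m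

/-- The two-variable series as a function of `x` and `z = x² y`. -/
noncomputable def regSeries (u : ℕ → ℂ) (p : ℂ × ℂ) : ℂ :=
  ∑' k : ℕ × ℕ, regCoeff u k.1 k.2 * p.1 ^ k.1 * p.2 ^ k.2

theorem exists_hasDoubleSeries_regSeries (a b c : ℂ) :
    ∃ ρ > 0, HasDoubleSeries (regSeries (aperySeq a b c)) (regCoeff (aperySeq a b c)) ρ := by
  obtain ⟨K, hK1, hK⟩ := exists_norm_aperySeq_le a b c
  have hK0 : 0 < K := by linarith
  -- With n = j + 2m, the bound (2K)^n 4^m splits as (2K)^j (16K²)^m.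
  refine ⟨min (K * 2)⁻¹ (16 * K ^ 2)⁻¹, by positivity, fun p h1 h2 => ?_⟩
  refine Summable.hasSum (summable_double_of_bound (C := 1) (K := K * 2) (L := 16 * K ^ 2)
    (by positivity) (by positivity) (fun j m => ?_) (h1.trans_le (min_le_left _ _))
    (h2.trans_le (min_le_right _ _)))
  rw [regCoeff, wzCoeff, norm_mul, one_mul]
  calc _ ≤ K ^ (j + 2 * m) * (2 ^ (j + 2 * m) * 4 ^ m) :=
        mul_le_mul (hK _) (norm_trinomialCoeff_le _ m) (norm_nonneg _) (by positivity)
    _ = _ := by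
        rw [show (16 : ℝ) = 2 ^ 2 * 4 by norm_num]
        simp only [pow_add, pow_mul, mul_pow]; ring

theorem regCoeff_succ_right (u : ℕ → ℂ) (j m : ℕ) :
    ((m : ℂ) + 1) ^ 2 * regCoeff u j (m + 1) =
      ((j : ℂ) + 2) * (j + 1) * regCoeff u (j + 2) m := by
  have h := trinomialCoeff_succ_right (j + 2 * (m + 1)) m
  have e : j + 2 + 2 * m = j + 2 * (m + 1) := by ring
  push_cast at h
  simp only [regCoeff, wzCoeff, e]
  linear_combination u (j + 2 * (m + 1)) * h

/-- This is the first equation at x^(j+2m+1) y^m. Terms missing at j = 0 or m = 0 are consistent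
because t(n, m) = 0 for n < 2m and the recursion has the factor n². -/
theorem regCoeff_rec (a b c : ℂ) (j m : ℕ) :
    ((j : ℂ) + 2 * m + 1) * (j + 1) * regCoeff (aperySeq a b c) (j + 1) m
      - (a * ((j : ℂ) + 2 * m) ^ 2 + a * (j + 2 * m) + b) * regCoeff (aperySeq a b c) j m
      + c * (shiftX (fun j m => ((j : ℂ) + 2 * m + 1) * (j + 1 + 4 * m) *
            regCoeff (aperySeq a b c) j m) j m
          + shiftY (fun j m => 4 * ((j : ℂ) + 2 * m + 2) * (j + 1) *
            regCoeff (aperySeq a b c) (j + 1) m) j m) = 0 := by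
  set u := aperySeq a b c with hu
  have h1 := trinomialCoeff_succ_left (j + 2 * m) m
  have h2 := aperySeq_rec a b c (j + 2 * m)
  rw [← hu] at h2
  have key : ((j : ℂ) + 2 * m) ^ 2 * u (j + 2 * m - 1) * trinomialCoeff (j + 2 * m) m =
      shiftX (fun j m => ((j : ℂ) + 2 * m + 1) * (j + 1 + 4 * m) * regCoeff u j m) j m
        + shiftY (fun j m => 4 * ((j : ℂ) + 2 * m + 2) * (j + 1) * regCoeff u (j + 1) m) j m := by
    rcases Nat.eq_zero_or_pos (j + 2 * m) with h0 | h0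
    · obtain rfl : j = 0 := by omega
      obtain rfl : m = 0 := by omega
      simp
    obtain ⟨M, hM⟩ : ∃ M, j + 2 * m = M + 1 := ⟨j + 2 * m - 1, by omega⟩
    have hMc : (j : ℂ) + 2 * m = M + 1 := by exact_mod_cast hM
    have h3 := trinomialCoeff_succ_left_eq M m
    have hX : shiftX (fun j m => ((j : ℂ) + 2 * m + 1) * (j + 1 + 4 * m) * regCoeff u j m) j m =
        (M + 1) * ((M : ℂ) + 1 + 2 * m) * u M * trinomialCoeff M m := by
      rcases j with _ | j
      · rw [trinomialCoeff_eq_zero (show M < 2 * m by omega)]; simp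
      · obtain rfl : M = j + 2 * m := by omega
        simp only [shiftX_succ, regCoeff, wzCoeff]; push_cast; ring
    have hY : shiftY (fun j m => 4 * ((j : ℂ) + 2 * m + 2) * (j + 1) * regCoeff u (j + 1) m) j m =
        (M + 1) * u M * shiftY (fun i j => (4 * (i : ℂ) - 8 * j) * trinomialCoeff i j) M m := by
      rcases m with _ | m
      · simp
      · obtain rfl : M = j + 1 + 2 * m := by omega
        simp only [shiftY_succ, regCoeff, wzCoeff]; push_cast; ring
    rw [hX, hY, hMc, hM, Nat.add_sub_cancel]
    linear_combination ((M : ℂ) + 1) * u M * h3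
  rw [← key]
  have e : j + 1 + 2 * m = j + 2 * m + 1 := by ring
  push_cast at h1 h2
  simp only [regCoeff, wzCoeff, e]
  linear_combination ((j : ℂ) + 2 * m + 1) * u (j + 2 * m + 1) * h1
    + trinomialCoeff (j + 2 * m) m * h2

/-- `∂F/∂x`. -/
noncomputable def partialX (F : ℂ × ℂ → ℂ) (p : ℂ × ℂ) : ℂ := deriv (fun s => F (s, p.2)) p.1

/-- `∂F/∂y`. -/
noncomputable def partialY (F : ℂ × ℂ → ℂ) (p : ℂ × ℂ) : ℂ := deriv (fun s => F (p.1, s)) p.2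

namespace HasDoubleSeries

variable {F : ℂ × ℂ → ℂ} {A : ℕ → ℕ → ℂ} {ρ : ℝ}

theorem partialX (hF : HasDoubleSeries F A ρ) :
    HasDoubleSeries (partialX F) (fun i j => ((i : ℂ) + 1) * A (i + 1) j) ρ := hF.deriv_fst

theorem partialY (hF : HasDoubleSeries F A ρ) :
    HasDoubleSeries (partialY F) (fun i j => ((j : ℂ) + 1) * A i (j + 1)) ρ := hF.deriv_snd

theorem fst_mul_partialX (hF : HasDoubleSeries F A ρ) :
    HasDoubleSeries (fun p => p.1 * _root_.partialX F p) (fun i j => (i : ℂ) * A i j) ρ :=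
  hF.thetaX

theorem snd_mul_partialY (hF : HasDoubleSeries F A ρ) :
    HasDoubleSeries (fun p => p.2 * _root_.partialY F p) (fun i j => (j : ℂ) * A i j) ρ :=
  hF.thetaY

theorem fst_mul_shift (hF : HasDoubleSeries F A ρ) :
    HasDoubleSeries (fun p => p.1 * F p) (shiftX A) ρ := hF.fst_mul

theorem snd_mul_shift (hF : HasDoubleSeries F A ρ) :
    HasDoubleSeries (fun p => p.2 * F p) (shiftY A) ρ := hF.snd_mul

theorem partialX_partialY (hF : HasDoubleSeries F A ρ) {p : ℂ × ℂ} (h1 : ‖p.1‖ < ρ)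
    (h2 : ‖p.2‖ < ρ) :
    _root_.partialX (_root_.partialY F) p = _root_.partialY (_root_.partialX F) p := by
  refine (hF.partialY.partialX p h1 h2).unique ?_
  refine HasSum.congr_fun (hF.partialX.partialY p h1 h2) fun k => ?_
  ring

/-- Chain rule along a curve near the origin. -/
theorem eventually_hasDerivAt (hρ : 0 < ρ) (hF : HasDoubleSeries F A ρ) :
    ∀ᶠ p in 𝓝 ((0, 0) : ℂ × ℂ), ∀ (x y : ℂ → ℂ) (x' y' s : ℂ), (x s, y s) = p →
      HasDerivAt x x' s → HasDerivAt y y' s →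
      HasDerivAt (fun s => F (x s, y s))
        (_root_.partialX F p * x' + _root_.partialY F p * y') s := by
  filter_upwards [(hF.analyticAt hρ).eventually_analyticAt] with p hp
  have hd : HasFDerivAt F (fderiv ℂ F p) p := hp.differentiableAt.hasFDerivAt
  have key : ∀ (x y : ℂ → ℂ) (x' y' s : ℂ), (x s, y s) = p →
      HasDerivAt x x' s → HasDerivAt y y' s →
      HasDerivAt (fun s => F (x s, y s)) (fderiv ℂ F p (x', y')) s := by
    intro x y x' y' s hs hx hy
    exact HasFDerivAt.comp_hasDerivAt s (by rw [hs]; exact hd) (hx.prodMk hy)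
  intro x y x' y' s hs hx hy
  -- The partial derivatives are read off the Fréchet derivative by moving along coordinate lines.
  have hpx : _root_.partialX F p = fderiv ℂ F p (1, 0) :=
    (key (fun s => s) (fun _ => p.2) 1 0 p.1 rfl (hasDerivAt_id _) (hasDerivAt_const _ _)).deriv
  have hpy : _root_.partialY F p = fderiv ℂ F p (0, 1) :=
    (key (fun _ => p.1) (fun s => s) 0 1 p.2 rfl (hasDerivAt_const _ _) (hasDerivAt_id _)).deriv
  have e : ((x', y') : ℂ × ℂ) = x' • (1, 0) + y' • (0, 1) := by simp
  have := key x y x' y' s hs hx hy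
  rw [e, map_add, map_smul, map_smul, smul_eq_mul, smul_eq_mul] at this
  rw [hpx, hpy]
  simpa only [mul_comm] using this

end HasDoubleSeries

/-- In the coordinates (x, z), θ_x becomes θ_x + 2θ_z and θ_y becomes θ_z. The second equation of
the system is then divided by z and the first by x. -/
theorem regSeries_pde {a b c : ℂ} {ρ : ℝ}
    (hT : HasDoubleSeries (regSeries (aperySeq a b c)) (regCoeff (aperySeq a b c)) ρ)
    {x z : ℂ} (hx : ‖x‖ < ρ) (hz : ‖z‖ < ρ) (T : ℂ × ℂ → ℂ) (hTdef : T = regSeries (aperySeq a b c)) :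
    (z * partialY (partialY T) (x, z) + partialY T (x, z) = partialX (partialX T) (x, z)) ∧
    (x - a * x ^ 2 + c * (x ^ 3 + 4 * x * z)) * partialX (partialX T) (x, z)
      + (2 * z - 4 * a * x * z + c * (6 * x ^ 2 * z + 8 * z ^ 2)) * partialY (partialX T) (x, z)
      + (-4 * a * z ^ 2 + 8 * c * x * z ^ 2) * partialY (partialY T) (x, z)
      + (1 - 2 * a * x + c * (3 * x ^ 2 + 8 * z)) * partialX T (x, z)
      + (-6 * a * z + 14 * c * x * z) * partialY T (x, z) + (-b + c * x) * T (x, z) = 0 := by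
  rw [← hTdef] at hT
  have hX := hT.partialX
  have hY := hT.partialY
  constructor
  · refine sub_eq_zero.mp (((hY.snd_mul_partialY.add hY).sub hX.partialX).eq_zero_of_coeff
      (fun j m => ?_) (p := (x, z)) hx hz)
    have := regCoeff_succ_right (aperySeq a b c) j m
    push_cast
    linear_combination this
  · have xXX := hX.fst_mul_partialX
    have zXY := hX.snd_mul_partialY
    have xX := hT.fst_mul_partialX
    have zY := hT.snd_mul_partialY
    have xxXX : HasDoubleSeries (fun p => p.1 * (p.1 * partialX (partialX T) p))
        (fun j m => (j : ℂ) * (j - 1) * regCoeff (aperySeq a b c) j m) ρ := by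
      refine xXX.fst_mul_shift.congr (fun _ _ _ => rfl) fun j m => ?_
      rcases j with _ | j <;> simp; ring
    have xzXY : HasDoubleSeries (fun p => p.1 * (p.2 * partialY (partialX T) p))
        (fun j m => (j : ℂ) * m * regCoeff (aperySeq a b c) j m) ρ := by
      refine zXY.fst_mul_shift.congr (fun _ _ _ => rfl) fun j m => ?_
      rcases j with _ | j <;> simp; ring
    have zzYY : HasDoubleSeries (fun p => p.2 * (p.2 * partialY (partialY T) p))
        (fun j m => (m : ℂ) * (m - 1) * regCoeff (aperySeq a b c) j m) ρ := by
      refine hY.snd_mul_partialY.snd_mul_shift.congr (fun _ _ _ => rfl) fun j m => ?_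
      rcases m with _ | m <;> simp; ring
    have h1 := (xXX.add (zXY.const_mul 2)).add hX
    have h2 := ((((xxXX.add (xzXY.const_mul 4)).add (zzYY.const_mul 4)).add
      ((xX.const_mul 2).add (zY.const_mul 6))).const_mul a).add (hT.const_mul b)
    have h3 := ((((hT.add (xX.const_mul 3)).add (zY.const_mul 14)).add xxXX).add
      ((xzXY.const_mul 6).add (zzYY.const_mul 8))).fst_mul_shift
    have h4 := (((hX.const_mul 8).add (xXX.const_mul 4)).add (zXY.const_mul 8)).snd_mul_shift
    have h := ((h1.sub h2).add ((h3.add h4).const_mul c)).eq_zero_of_coeff (fun j m => ?_)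
      (p := (x, z)) hx hz
    · linear_combination h
    · have := regCoeff_rec a b c j m
      rcases j with _ | j <;> rcases m with _ | m <;>
        simp only [shiftX_zero, shiftX_succ, shiftY_zero, shiftY_succ] at this ⊢ <;>
        push_cast at this ⊢ <;> linear_combination this

/-! ### The substitution (X, Y) ↦ (x, z) and its X-derivatives. -/

/-- `x² y` as a function of `(X, Y)`. -/
noncomputable def wzZ (a c X Y : ℂ) : ℂ :=
  X * Y * (1 - a * X + c * X ^ 2) * (1 - a * Y + c * Y ^ 2) / (1 - c * X * Y) ^ 4

/-- `∂x/∂X`. -/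
noncomputable def wzX₁ (a c X Y : ℂ) : ℂ :=
  (1 + c * X * Y + c * Y * (X + Y) - 2 * a * Y) / (1 - c * X * Y) ^ 2
    + 2 * (c * Y) * wzNum a c X Y / (1 - c * X * Y) ^ 3

/-- `∂²x/∂X²`. -/
noncomputable def wzX₂ (a c X Y : ℂ) : ℂ :=
  2 * (c * Y) / (1 - c * X * Y) ^ 2
    + 4 * (c * Y) * (1 + c * X * Y + c * Y * (X + Y) - 2 * a * Y) / (1 - c * X * Y) ^ 3
    + 6 * (c * Y) ^ 2 * wzNum a c X Y / (1 - c * X * Y) ^ 4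

/-- `∂z/∂X` for `z = x² y`. -/
noncomputable def wzZ₁ (a c X Y : ℂ) : ℂ :=
  Y * (1 - a * Y + c * Y ^ 2) * ((1 - 2 * a * X + 3 * c * X ^ 2) / (1 - c * X * Y) ^ 4
    + 4 * (c * Y) * (X * (1 - a * X + c * X ^ 2)) / (1 - c * X * Y) ^ 5)

/-- `∂²z/∂X²` for `z = x² y`. -/
noncomputable def wzZ₂ (a c X Y : ℂ) : ℂ :=
  Y * (1 - a * Y + c * Y ^ 2) * ((-2 * a + 6 * c * X) / (1 - c * X * Y) ^ 4
    + 8 * (c * Y) * (1 - 2 * a * X + 3 * c * X ^ 2) / (1 - c * X * Y) ^ 5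
    + 20 * (c * Y) ^ 2 * (X * (1 - a * X + c * X ^ 2)) / (1 - c * X * Y) ^ 6)

section Derivatives

variable {a c X Y : ℂ}

theorem hasDerivAt_one_sub (c X Y : ℂ) :
    HasDerivAt (fun s : ℂ => 1 - c * s * Y) (-(c * Y)) X := by
  have h := (((hasDerivAt_id X).const_mul c).mul_const Y).const_sub 1
  simpa using h

/-- As functions of X, both x and z are polynomials over powers of 1 - cXY, so this one quotient
rule yields all their derivatives. -/
theorem hasDerivAt_div_pow {f : ℂ → ℂ} {f' : ℂ} (hf : HasDerivAt f f' X)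
    (hw : 1 - c * X * Y ≠ 0) (n : ℕ) :
    HasDerivAt (fun s => f s / (1 - c * s * Y) ^ n)
      (f' / (1 - c * X * Y) ^ n + n * (c * Y) * f X / (1 - c * X * Y) ^ (n + 1)) X := by
  convert! hf.div ((hasDerivAt_one_sub c X Y).fun_pow n) (pow_ne_zero n hw) using 1
  rcases n with _ | n
  · simp
  · simp only [Nat.add_sub_cancel]
    field_simp
    ring

theorem hasDerivAt_wzNum (a c X Y : ℂ) :
    HasDerivAt (fun s => wzNum a c s Y) (1 + c * X * Y + c * Y * (X + Y) - 2 * a * Y) X := by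
  have h := (((hasDerivAt_id X).add_const Y).mul
    ((((hasDerivAt_id X).const_mul c).mul_const Y).const_add 1)).sub
    (((hasDerivAt_id X).const_mul (2 * a)).mul_const Y)
  convert! h using 1
  simp; ring

theorem hasDerivAt_wzNum' (a c X Y : ℂ) :
    HasDerivAt (fun s => 1 + c * s * Y + c * Y * (s + Y) - 2 * a * Y) (2 * (c * Y)) X := by
  have h := (((((hasDerivAt_id X).const_mul c).mul_const Y).const_add 1).add
    (((hasDerivAt_id X).add_const Y).const_mul (c * Y))).sub_const (2 * a * Y)
  convert! h using 1
  simp; ring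

theorem hasDerivAt_cubic (a c X : ℂ) :
    HasDerivAt (fun s => s * (1 - a * s + c * s ^ 2)) (1 - 2 * a * X + 3 * c * X ^ 2) X := by
  have h := (hasDerivAt_id X).mul ((((hasDerivAt_id X).const_mul a).const_sub 1).add
    (((hasDerivAt_id X).pow 2).const_mul c))
  convert! h using 1
  simp; ring

theorem hasDerivAt_cubic' (a c X : ℂ) :
    HasDerivAt (fun s => 1 - 2 * a * s + 3 * c * s ^ 2) (-2 * a + 6 * c * X) X := by
  have h := ((((hasDerivAt_id X).const_mul (2 * a)).const_sub 1).add
    (((hasDerivAt_id X).pow 2).const_mul (3 * c)))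
  convert! h using 1
  simp; ring

theorem hasDerivAt_wzX (hw : 1 - c * X * Y ≠ 0) :
    HasDerivAt (fun s => wzX a c s Y) (wzX₁ a c X Y) X := by
  convert! hasDerivAt_div_pow (hasDerivAt_wzNum a c X Y) hw 2 using 1

theorem hasDerivAt_wzX₁ (hw : 1 - c * X * Y ≠ 0) :
    HasDerivAt (fun s => wzX₁ a c s Y) (wzX₂ a c X Y) X := by
  convert! (hasDerivAt_div_pow (hasDerivAt_wzNum' a c X Y) hw 2).add
    (hasDerivAt_div_pow ((hasDerivAt_wzNum a c X Y).const_mul (2 * (c * Y))) hw 3) using 1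
  simp only [wzX₂]
  push_cast
  ring

theorem hasDerivAt_wzZ (hw : 1 - c * X * Y ≠ 0) :
    HasDerivAt (fun s => wzZ a c s Y) (wzZ₁ a c X Y) X := by
  have h := (hasDerivAt_div_pow (hasDerivAt_cubic a c X) hw 4).const_mul
    (Y * (1 - a * Y + c * Y ^ 2))
  convert! h using 1
  ext s
  simp only [wzZ]
  ring

theorem hasDerivAt_wzZ₁ (hw : 1 - c * X * Y ≠ 0) :
    HasDerivAt (fun s => wzZ₁ a c s Y) (wzZ₂ a c X Y) X := by
  have h := ((hasDerivAt_div_pow (hasDerivAt_cubic' a c X) hw 4).add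
    (hasDerivAt_div_pow ((hasDerivAt_cubic a c X).const_mul (4 * (c * Y))) hw 5)).const_mul
    (Y * (1 - a * Y + c * Y ^ 2))
  convert! h using 1
  simp only [wzZ₂]
  push_cast
  ring

end Derivatives

/-! ### The Apéry operator on the pulled-back series. -/

/-- The Apéry-type operator in `X` applied to `T(x, z) / (1 - cXY)` is a combination of the two
equations satisfied by `T`. -/
theorem apery_operator_identity {a b c X Y x z x₁ x₂ z₁ z₂ Txx Txz Tzz Tx Tz T G G₁ G₂ : ℂ}
    (hw : 1 - c * X * Y ≠ 0) (hx : x = wzX a c X Y) (hz : z = wzZ a c X Y)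
    (hx₁ : x₁ = wzX₁ a c X Y) (hx₂ : x₂ = wzX₂ a c X Y)
    (hz₁ : z₁ = wzZ₁ a c X Y) (hz₂ : z₂ = wzZ₂ a c X Y)
    (h₂ : z * Tzz + Tz = Txx)
    (h₁ : (x - a * x ^ 2 + c * (x ^ 3 + 4 * x * z)) * Txx
      + (2 * z - 4 * a * x * z + c * (6 * x ^ 2 * z + 8 * z ^ 2)) * Txz
      + (-4 * a * z ^ 2 + 8 * c * x * z ^ 2) * Tzz
      + (1 - 2 * a * x + c * (3 * x ^ 2 + 8 * z)) * Tx
      + (-6 * a * z + 14 * c * x * z) * Tz + (-b + c * x) * T = 0)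
    (hG : G = T / (1 - c * X * Y))
    (hG₁ : G₁ = (Tx * x₁ + Tz * z₁) / (1 - c * X * Y) + c * Y * T / (1 - c * X * Y) ^ 2)
    (hG₂ : G₂ = (Txx * x₁ ^ 2 + 2 * Txz * x₁ * z₁ + Tzz * z₁ ^ 2 + Tx * x₂ + Tz * z₂)
        / (1 - c * X * Y) + 2 * (c * Y) * (Tx * x₁ + Tz * z₁) / (1 - c * X * Y) ^ 2
        + 2 * (c * Y) ^ 2 * T / (1 - c * X * Y) ^ 3) :
    (1 - a * X + c * X ^ 2) * (X * (G₁ + X * G₂)) + (-a * X + 2 * c * X ^ 2) * (X * G₁)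
      + (-b * X + c * X ^ 2) * G = 0 := by
  -- Coefficients of the derivatives of T are compared with X `h₁` + λ `h₂`. Matching Txx forces λ =
  -- X(x - ax² + c(x³ + 4xz)) - (1 - aX + cX²) X² x₁²; the remaining five comparisons are rational
  -- identities in X and Y.
  have cxz : (1 - a * X + c * X ^ 2) * X ^ 2 * (2 * x₁ * z₁) =
      X * (2 * z - 4 * a * x * z + c * (6 * x ^ 2 * z + 8 * z ^ 2)) := by
    rw [hx, hz, hx₁, hz₁, wzX, wzZ, wzX₁, wzZ₁, wzNum]
    -- The denominator is an atom while fractions are cleared, then is expanded again for the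
    -- polynomial identity.
    generalize hwdef : 1 - c * X * Y = w at hw ⊢
    field_simp
    rw [← hwdef]
    ring
  have czz : (1 - a * X + c * X ^ 2) * X ^ 2 * z₁ ^ 2 =
      X * (-4 * a * z ^ 2 + 8 * c * x * z ^ 2) + (X * (x - a * x ^ 2 + c * (x ^ 3 + 4 * x * z))
        - (1 - a * X + c * X ^ 2) * X ^ 2 * x₁ ^ 2) * z := by
    rw [hx, hz, hx₁, hz₁, wzX, wzZ, wzX₁, wzZ₁, wzNum]
    generalize hwdef : 1 - c * X * Y = w at hw ⊢
    field_simp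
    rw [← hwdef]
    ring
  have cx : (1 - a * X + c * X ^ 2) * (X * x₁ + X ^ 2 * (x₂ + 2 * (c * Y) * x₁ / (1 - c * X * Y)))
      + (-a * X + 2 * c * X ^ 2) * X * x₁ =
      X * (1 - 2 * a * x + c * (3 * x ^ 2 + 8 * z)) := by
    rw [hx, hz, hx₁, hx₂, wzX, wzZ, wzX₁, wzX₂, wzNum]
    generalize hwdef : 1 - c * X * Y = w at hw ⊢
    field_simp
    rw [← hwdef]
    ring
  have cz : (1 - a * X + c * X ^ 2) * (X * z₁ + X ^ 2 * (z₂ + 2 * (c * Y) * z₁ / (1 - c * X * Y)))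
      + (-a * X + 2 * c * X ^ 2) * X * z₁ =
      X * (-6 * a * z + 14 * c * x * z) + (X * (x - a * x ^ 2 + c * (x ^ 3 + 4 * x * z))
        - (1 - a * X + c * X ^ 2) * X ^ 2 * x₁ ^ 2) := by
    rw [hx, hz, hx₁, hz₁, hz₂, wzX, wzZ, wzX₁, wzZ₁, wzZ₂, wzNum]
    generalize hwdef : 1 - c * X * Y = w at hw ⊢
    field_simp
    rw [← hwdef]
    ring
  have cT : (1 - a * X + c * X ^ 2) * (X * (c * Y / (1 - c * X * Y))
        + X ^ 2 * (2 * (c * Y) ^ 2 / (1 - c * X * Y) ^ 2))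
      + (-a * X + 2 * c * X ^ 2) * X * (c * Y / (1 - c * X * Y)) + (-b * X + c * X ^ 2) =
      X * (-b + c * x) := by
    rw [hx, wzX, wzNum]
    generalize hwdef : 1 - c * X * Y = w at hw ⊢
    field_simp
    rw [← hwdef]
    ring
  have key : ((1 - a * X + c * X ^ 2) * (X * (G₁ + X * G₂)) + (-a * X + 2 * c * X ^ 2) * (X * G₁)
      + (-b * X + c * X ^ 2) * G) =
      (((1 - a * X + c * X ^ 2) * X ^ 2 * x₁ ^ 2) * Txx
      + ((1 - a * X + c * X ^ 2) * X ^ 2 * (2 * x₁ * z₁)) * Txz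
      + ((1 - a * X + c * X ^ 2) * X ^ 2 * z₁ ^ 2) * Tzz
      + ((1 - a * X + c * X ^ 2) * (X * x₁ + X ^ 2 * (x₂ + 2 * (c * Y) * x₁ / (1 - c * X * Y)))
        + (-a * X + 2 * c * X ^ 2) * X * x₁) * Tx
      + ((1 - a * X + c * X ^ 2) * (X * z₁ + X ^ 2 * (z₂ + 2 * (c * Y) * z₁ / (1 - c * X * Y)))
        + (-a * X + 2 * c * X ^ 2) * X * z₁) * Tz
      + ((1 - a * X + c * X ^ 2) * (X * (c * Y / (1 - c * X * Y))
        + X ^ 2 * (2 * (c * Y) ^ 2 / (1 - c * X * Y) ^ 2))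
        + (-a * X + 2 * c * X ^ 2) * X * (c * Y / (1 - c * X * Y)) + (-b * X + c * X ^ 2)) * T)
      / (1 - c * X * Y) := by
    rw [hG, hG₁, hG₂]
    generalize 1 - c * X * Y = w
    ring
  rw [key, cxz, czz, cx, cz, cT, div_eq_zero_iff]
  left
  linear_combination X * h₁ + (X * (x - a * x ^ 2 + c * (x ^ 3 + 4 * x * z))
        - (1 - a * X + c * X ^ 2) * X ^ 2 * x₁ ^ 2) * h₂

/-- `T(x(X, Y), z(X, Y)) / (1 - cXY)` where `T` is the two-variable series in `x` and `z = x² y`. -/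
noncomputable def pulledSeries (a b c : ℂ) (p : ℂ × ℂ) : ℂ :=
  regSeries (aperySeq a b c) (wzX a c p.1 p.2, wzZ a c p.1 p.2) / (1 - c * p.1 * p.2)

/-- The operator `θ² - X(aθ² + aθ + b) + cX²(θ + 1)²` in the first variable. -/
noncomputable def aperyOp (a b c : ℂ) (F : ℂ × ℂ → ℂ) (p : ℂ × ℂ) : ℂ :=
  thetaX (thetaX F) p - p.1 * (a * thetaX (thetaX F) p + a * thetaX F p + b * F p)
    + c * (p.1 * (p.1 * (thetaX (thetaX F) p + 2 * thetaX F p + F p)))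

theorem eventually_wz_small (a c : ℂ) {P : ℂ × ℂ → Prop}
    (hP : ∀ᶠ p in 𝓝 ((0, 0) : ℂ × ℂ), P p) :
    ∀ᶠ p in 𝓝 ((0, 0) : ℂ × ℂ),
      1 - c * p.1 * p.2 ≠ 0 ∧ P (wzX a c p.1 p.2, wzZ a c p.1 p.2) := by
  have h1 : ContinuousAt (fun p : ℂ × ℂ => 1 - c * p.1 * p.2) (0, 0) := by fun_prop
  have h2 : ContinuousAt (fun p : ℂ × ℂ => (wzX a c p.1 p.2, wzZ a c p.1 p.2)) (0, 0) := by
    unfold wzX wzZ wzNum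
    refine ContinuousAt.prodMk (ContinuousAt.div₀ (by fun_prop) (by fun_prop) (by simp))
      (ContinuousAt.div₀ (by fun_prop) (by fun_prop) (by simp))
  refine (h1.eventually_ne (by simp)).and (h2.eventually ?_)
  simpa [wzX, wzZ, wzNum] using hP

theorem analyticAt_pulledSeries (a b c : ℂ) : AnalyticAt ℂ (pulledSeries a b c) (0, 0) := by
  obtain ⟨ρ, hρ, hT⟩ := exists_hasDoubleSeries_regSeries a b c
  have hx : AnalyticAt ℂ (fun p : ℂ × ℂ => wzX a c p.1 p.2) (0, 0) := by
    unfold wzX wzNum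
    exact AnalyticAt.div (ContDiffAt.analyticAt (by fun_prop)) (ContDiffAt.analyticAt (by fun_prop)) (by simp)
  have hz : AnalyticAt ℂ (fun p : ℂ × ℂ => wzZ a c p.1 p.2) (0, 0) := by
    unfold wzZ
    exact AnalyticAt.div (ContDiffAt.analyticAt (by fun_prop)) (ContDiffAt.analyticAt (by fun_prop)) (by simp)
  refine AnalyticAt.div (AnalyticAt.fun_comp ?_ (hx.prod hz)) (ContDiffAt.analyticAt (by fun_prop)) (by simp)
  simpa [wzX, wzZ, wzNum] using hT.analyticAt hρ

theorem aperyOp_pulledSeries (a b c : ℂ) :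
    ∀ᶠ p in 𝓝 ((0, 0) : ℂ × ℂ), aperyOp a b c (pulledSeries a b c) p = 0 := by
  obtain ⟨ρ, hρ, hT⟩ := exists_hasDoubleSeries_regSeries a b c
  set T := regSeries (aperySeq a b c) with hTdef
  have hgood := eventually_wz_small a c
    ((((hT.eventually_hasDerivAt hρ).and (hT.partialX.eventually_hasDerivAt hρ)).and
      (hT.partialY.eventually_hasDerivAt hρ)).and (eventually_norm_lt hρ))
  have hderiv₁ : ∀ᶠ p in 𝓝 ((0, 0) : ℂ × ℂ),
      thetaX (pulledSeries a b c) p = p.1 *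
        ((partialX T (wzX a c p.1 p.2, wzZ a c p.1 p.2) * wzX₁ a c p.1 p.2
          + partialY T (wzX a c p.1 p.2, wzZ a c p.1 p.2) * wzZ₁ a c p.1 p.2)
            / (1 - c * p.1 * p.2)
          + c * p.2 * T (wzX a c p.1 p.2, wzZ a c p.1 p.2) / (1 - c * p.1 * p.2) ^ 2) := by
    filter_upwards [hgood] with p hp
    obtain ⟨hw, ⟨⟨hd, -⟩, -⟩, -⟩ := hp
    have h := hasDerivAt_div_pow (hd _ _ _ _ p.1 rfl (hasDerivAt_wzX hw) (hasDerivAt_wzZ hw)) hw 1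
    simp only [pow_one, Nat.cast_one, one_mul] at h
    exact congrArg (p.1 * ·) h.deriv
  filter_upwards [hgood, hderiv₁, hderiv₁.eventually_nhds] with p hp hp₁ hp₂
  obtain ⟨hw, ⟨⟨hd, hdX⟩, hdY⟩, hn1, hn2⟩ := hp
  set q : ℂ × ℂ := (wzX a c p.1 p.2, wzZ a c p.1 p.2) with hq
  have hTX := hdX _ _ _ _ p.1 rfl (hasDerivAt_wzX hw) (hasDerivAt_wzZ hw)
  have hTY := hdY _ _ _ _ p.1 rfl (hasDerivAt_wzX hw) (hasDerivAt_wzZ hw)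
  have hTT := hd _ _ _ _ p.1 rfl (hasDerivAt_wzX hw) (hasDerivAt_wzZ hw)
  have hnum := (hTX.mul (hasDerivAt_wzX₁ (a := a) hw)).add (hTY.mul (hasDerivAt_wzZ₁ (a := a) hw))
  have hG₁ := (hasDerivAt_div_pow hnum hw 1).add
    (hasDerivAt_div_pow (hTT.const_mul (c * p.2)) hw 2)
  have hG := (hasDerivAt_id p.1).mul hG₁
  -- Differentiating a second time requires the first-derivative formula on a whole neighbourhood of
  -- p.1, not only at the point.
  have hcurve : ∀ᶠ s in 𝓝 p.1, thetaX (pulledSeries a b c) (s, p.2) = s *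
        ((partialX T (wzX a c s p.2, wzZ a c s p.2) * wzX₁ a c s p.2
          + partialY T (wzX a c s p.2, wzZ a c s p.2) * wzZ₁ a c s p.2)
            / (1 - c * s * p.2)
          + c * p.2 * T (wzX a c s p.2, wzZ a c s p.2) / (1 - c * s * p.2) ^ 2) := by
    have : ContinuousAt (fun s : ℂ => (s, p.2)) p.1 := by fun_prop
    exact this.eventually hp₂
  have hθ := (hG.congr_of_eventuallyEq (f₁ := fun s => thetaX (pulledSeries a b c) (s, p.2)) (by
    filter_upwards [hcurve] with s hs
    simpa using hs)).deriv
  have hθθ : thetaX (thetaX (pulledSeries a b c)) p =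
    p.1 * deriv (fun s => thetaX (pulledSeries a b c) (s, p.2)) p.1 := rfl
  rw [hθ] at hθθ
  have hpde := regSeries_pde hT hn1 hn2 T hTdef
  have hsymm := hT.partialX_partialY (p := q) hn1 hn2
  simp only [Pi.mul_apply, Pi.add_apply, id_eq, pow_one] at hθθ
  rw [← hq, hsymm] at hθθ
  have key := apery_operator_identity (G := pulledSeries a b c p) hw rfl rfl rfl rfl rfl rfl
    hpde.1 hpde.2 rfl rfl rfl
  rw [← hq] at key
  rw [aperyOp, hθθ, hp₁]
  linear_combination key

/-! ### Factorization of the pulled-back series. -/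

/-- The action of `aperyOp` on coefficients. -/
noncomputable def aperyCoeff (a b c : ℂ) (A : ℕ → ℕ → ℂ) (i j : ℕ) : ℂ :=
  (i : ℂ) ^ 2 * A i j - shiftX (fun i j => (a * i ^ 2 + a * i + b) * A i j) i j
    + c * shiftX (shiftX fun i j => ((i : ℂ) + 1) ^ 2 * A i j) i j

theorem HasDoubleSeries.aperyOp {F : ℂ × ℂ → ℂ} {A : ℕ → ℕ → ℂ} {ρ : ℝ} (a b c : ℂ)
    (hF : HasDoubleSeries F A ρ) :
    HasDoubleSeries (aperyOp a b c F) (aperyCoeff a b c A) ρ := by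
  have hX := hF.thetaX
  have h2 := (((hX.thetaX.const_mul a).add (hX.const_mul a)).add (hF.const_mul b)).fst_mul
  have h3 := ((hX.thetaX.add (hX.const_mul 2)).add hF).fst_mul.fst_mul.const_mul c
  refine ((hX.thetaX.sub h2).add h3).congr (fun p _ _ => rfl) fun i j => ?_
  rcases i with _ | _ | i
  · simp [aperyCoeff]
  · simp [aperyCoeff]
  · simp [aperyCoeff]; ring

/-- For fixed j the array satisfies the Apéry recursion in i, whose leading factor (n + 1)² is
nonzero, so its initial value determines it. -/
theorem eq_mul_of_aperyCoeff {a b c : ℂ} {A : ℕ → ℕ → ℂ}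
    (h : ∀ i j, aperyCoeff a b c A i j = 0) (i j : ℕ) : A i j = aperySeq a b c i * A 0 j := by
  induction i using Nat.strong_induction_on with
  | _ i ih =>
    rcases i with _ | n
    · simp [aperySeq]
    have hn : ((n : ℂ) + 1) ^ 2 ≠ 0 := pow_ne_zero _ (by exact_mod_cast Nat.succ_ne_zero n)
    apply mul_left_cancel₀ hn
    have hr := aperySeq_rec a b c n
    have hA := h (n + 1) j
    have i1 := ih n (by omega)
    rcases n with _ | n
    · simp [aperyCoeff, aperySeq] at hA ⊢
      linear_combination hA
    · have i0 := ih n (by omega)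
      simp only [aperyCoeff, shiftX_succ, i1, i0] at hA
      simp only [Nat.add_sub_cancel] at hr
      push_cast at hA hr ⊢
      linear_combination hA - A 0 j * hr

theorem summable_aperySeq {a b c : ℂ} :
    ∃ ρ > 0, ∀ x : ℂ, ‖x‖ < ρ → Summable fun n => ‖aperySeq a b c n * x ^ n‖ := by
  obtain ⟨K, hK1, hK⟩ := exists_norm_aperySeq_le a b c
  have hK0 : 0 < K := by linarith
  refine ⟨K⁻¹, by positivity, fun x hx => ?_⟩
  have hlt : K * ‖x‖ < 1 := by
    rw [mul_comm]; exact (lt_inv_mul_iff₀' hK0).mp (by simpa using hx)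
  refine (summable_geometric_of_lt_one (by positivity) hlt).of_nonneg_of_le
    (fun n => norm_nonneg _) fun n => ?_
  rw [norm_mul, norm_pow, mul_pow]
  gcongr
  exact hK n

theorem injective_zero_prodMk : Function.Injective (fun j : ℕ => ((0, j) : ℕ × ℕ)) :=
  fun _ _ h => (Prod.mk.inj h).2

/-- Restriction of a double series to `x = 0`. -/
theorem HasDoubleSeries.hasSum_zero_left {F : ℂ × ℂ → ℂ} {A : ℕ → ℕ → ℂ} {ρ : ℝ}
    (hρ : 0 < ρ) (hF : HasDoubleSeries F A ρ) {y : ℂ} (hy : ‖y‖ < ρ) :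
    HasSum (fun j => A 0 j * y ^ j) (F (0, y)) := by
  have h := hF (0, y) (by simpa using hρ) hy
  rw [← injective_zero_prodMk.hasSum_iff] at h
  · simpa [Function.comp_def] using h
  · rintro ⟨i, j⟩ hk
    rcases i with _ | i
    · exact absurd ⟨j, rfl⟩ hk
    · simp

theorem hasSum_mul_of_summable_norm {f g : ℕ → ℂ} (hf : Summable fun n => ‖f n‖)
    (hg : Summable fun n => ‖g n‖) :
    HasSum (fun k : ℕ × ℕ => f k.1 * g k.2) ((∑' n, f n) * ∑' n, g n) :=
  hf.of_norm.hasSum.mul hg.of_norm.hasSum (summable_mul_of_summable_norm hf hg)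

theorem pulledSeries_eq_mul (a b c : ℂ) :
    ∀ᶠ p in 𝓝 ((0, 0) : ℂ × ℂ), pulledSeries a b c p =
      (∑' n, aperySeq a b c n * p.1 ^ n) * ∑' n, aperySeq a b c n * p.2 ^ n := by
  obtain ⟨B, ρ₁, hρ₁, hB⟩ := (analyticAt_pulledSeries a b c).exists_hasDoubleSeries
  obtain ⟨ρ₂, hρ₂, hT⟩ := exists_hasDoubleSeries_regSeries a b c
  obtain ⟨ρ₃, hρ₃, hu⟩ := summable_aperySeq (a := a) (b := b) (c := c)
  have hrec := eq_mul_of_aperyCoeff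
    ((hB.aperyOp a b c).coeff_eq_zero hρ₁ (aperyOp_pulledSeries a b c))
  have hB0 : ∀ j, B 0 j = aperySeq a b c j := by
    intro j
    refine sub_eq_zero.mp (coeff_eq_zero_of_hasSum_zero
      (α := fun j => B 0 j - aperySeq a b c j) (lt_min hρ₁ hρ₂) (fun y hy => ?_) j)
    have h1 := hB.hasSum_zero_left hρ₁ (hy.trans_le (min_le_left _ _))
    have h2 := hT.swap.hasSum_zero_left hρ₂ (hy.trans_le (min_le_right _ _))
    -- At X = 0: x = Y, z = 0 and 1 - cXY = 1.
    have e : pulledSeries a b c (0, y) = regSeries (aperySeq a b c) (y, 0) := by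
      simp [pulledSeries, wzX, wzZ, wzNum]
    rw [e] at h1
    have h3 := h1.sub h2
    simp only [Prod.swap_prod_mk, sub_self] at h3
    refine HasSum.congr_fun h3 fun j => ?_
    simp only [regCoeff, wzCoeff, trinomialCoeff_zero, mul_zero, add_zero]
    ring
  filter_upwards [eventually_norm_lt (lt_min hρ₁ hρ₃)] with p hp
  have hX := hu p.1 (hp.1.trans_le (min_le_right _ _))
  have hY := hu p.2 (hp.2.trans_le (min_le_right _ _))
  have h := hB p (hp.1.trans_le (min_le_left _ _)) (hp.2.trans_le (min_le_left _ _))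
  refine h.unique (HasSum.congr_fun (hasSum_mul_of_summable_norm hX hY) fun k => ?_)
  rw [hrec, hB0]
  ring

/-! ### Return to the variables x, y and conclusion. -/

/-- Passing from the series in `x, z = x² y` to the series in `x, y`. -/
theorem hasSum_wzTerm_of_reg {u : ℕ → ℂ} {x y z s : ℂ} (hz : x ^ 2 * y = z)
    (h : HasSum (fun k : ℕ × ℕ => regCoeff u k.1 k.2 * x ^ k.1 * z ^ k.2) s) :
    HasSum (wzTerm u x y) s := by
  apply hasSum_wzTerm
  have hinj : Function.Injective (fun k : ℕ × ℕ => (k.1 + 2 * k.2, k.2)) := by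
    rintro ⟨i, j⟩ ⟨i', j'⟩ h
    simp only [Prod.mk.injEq] at h ⊢
    omega
  rw [← hinj.hasSum_iff]
  · refine HasSum.congr_fun h fun k => ?_
    simp only [Function.comp, regCoeff, ← hz]
    ring
  -- The pairs missed by (j, m) ↦ (j + 2m, m) are those with n < 2m, where the coefficient vanishes.
  · rintro ⟨n, m⟩ hk
    have : n < 2 * m := by
      by_contra hnm
      exact hk ⟨(n - 2 * m, m), by simp only [Prod.mk.injEq, and_true]; omega⟩
    simp [wzCoeff, trinomialCoeff_eq_zero this]

/-- Since y can be large arbitrarily close to the origin, convergence comes from smallness of x and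
z = x² y; `wzNum` ≠ 0 serves only to recover z from x and y. -/
theorem hasSum_wzTerm_wzX_wzY (a b c : ℂ) :
    ∀ᶠ p in 𝓝 ((0, 0) : ℂ × ℂ), wzNum a c p.1 p.2 ≠ 0 →
      1 - c * p.1 * p.2 ≠ 0 ∧
      Summable (fun n : ℕ => aperySeq a b c n * p.1 ^ n) ∧
      Summable (fun n : ℕ => aperySeq a b c n * p.2 ^ n) ∧
      HasSum (wzTerm (aperySeq a b c) (wzX a c p.1 p.2) (wzY a c p.1 p.2))
        ((1 - c * p.1 * p.2) * (∑' n : ℕ, aperySeq a b c n * p.1 ^ n)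
          * (∑' n : ℕ, aperySeq a b c n * p.2 ^ n)) := by
  obtain ⟨ρ₂, hρ₂, hT⟩ := exists_hasDoubleSeries_regSeries a b c
  obtain ⟨ρ₃, hρ₃, hu⟩ := summable_aperySeq (a := a) (b := b) (c := c)
  filter_upwards [pulledSeries_eq_mul a b c, eventually_norm_lt hρ₃,
    eventually_wz_small a c (eventually_norm_lt hρ₂)] with p hG hp hsmall hN
  obtain ⟨hw, h1, h2⟩ := hsmall
  have hX := (hu _ hp.1).of_norm
  have hY := (hu _ hp.2).of_norm
  refine ⟨hw, hX, hY, ?_⟩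
  have hval : (1 - c * p.1 * p.2) * (∑' n : ℕ, aperySeq a b c n * p.1 ^ n)
      * (∑' n : ℕ, aperySeq a b c n * p.2 ^ n) =
      regSeries (aperySeq a b c) (wzX a c p.1 p.2, wzZ a c p.1 p.2) := by
    rw [mul_assoc, ← hG]
    exact mul_div_cancel₀ _ hw
  have hz : wzX a c p.1 p.2 ^ 2 * wzY a c p.1 p.2 = wzZ a c p.1 p.2 := by
    simp only [wzX, wzY, wzZ]
    field_simp
  have h := hT (wzX a c p.1 p.2, wzZ a c p.1 p.2) h1 h2
  rw [hval]
  exact hasSum_wzTerm_of_reg hz h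

theorem wzSeries_zero (a b c : ℂ) : wzSeries (aperySeq a b c) (0, 0) = 1 := by
  obtain ⟨ρ, hρ, h, -⟩ := exists_hasDoubleSeries_wzSeries a b c
  refine (h.hasSum_zero_left hρ (y := 0) (by simpa using hρ)).unique ?_
  refine (hasSum_ite_eq 0 (1 : ℂ)).congr_fun fun j => ?_
  rcases j with _ | j <;> simp [wzCoeff, aperySeq, trinomialCoeff_zero]

theorem mainTheorem5 (a b c : ℂ) (habc : (a, b, c) ∈ sporadicTriples) :
    (∀ᶠ p in 𝓝 ((0, 0) : ℂ × ℂ), wzNum a c p.1 p.2 ≠ 0 →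
      1 - c * p.1 * p.2 ≠ 0 ∧
      Summable (fun n : ℕ => aperySeq a b c n * p.1 ^ n) ∧
      Summable (fun n : ℕ => aperySeq a b c n * p.2 ^ n) ∧
      HasSum (wzTerm (aperySeq a b c) (wzX a c p.1 p.2) (wzY a c p.1 p.2))
        ((1 - c * p.1 * p.2) * (∑' n : ℕ, aperySeq a b c n * p.1 ^ n)
          * (∑' n : ℕ, aperySeq a b c n * p.2 ^ n))) ∧
    (∀ᶠ p in 𝓝 ((0, 0) : ℂ × ℂ), Summable (wzTerm (aperySeq a b c) p.1 p.2)) ∧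
    wzSeries (aperySeq a b c) (0, 0) = 1 ∧
    IsHolSolution a b c (wzSeries (aperySeq a b c)) ∧
    (∀ F : ℂ × ℂ → ℂ, IsHolSolution a b c F →
      ∃ k : ℂ, F =ᶠ[𝓝 ((0, 0) : ℂ × ℂ)] fun p => k * wzSeries (aperySeq a b c) p) := by
  refine ⟨hasSum_wzTerm_wzX_wzY a b c, ?_, wzSeries_zero a b c, isHolSolution_wzSeries a b c,
    fun F hF => hF.eq_const_mul⟩
  obtain ⟨ρ, hρ, -, hs⟩ := exists_hasDoubleSeries_wzSeries a b c
  filter_upwards [eventually_norm_lt hρ] with p hp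
  exact hs p hp.1 hp.2
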